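/- Let $R$ be a commutative Noetherian ring, let $\Phi=(c_{ij})$ be a $g\times f$ matrix over $R$, let $M=\operatorname{coker}(\Phi\colon R^f\to R^g)$, and let $L$ be a finitely generated $R$-module with $M\otimes_R L\neq 0$. Let $\nu$ be an integer with $0\le \nu<f-g$, and let $I_g(\Phi)$ be the ideal generated by the $g\times g$ minors of $\Phi$. Let $S=R[T_1,\dots,T_g]$ with its standard grading, $\mathfrak t=(T_1,\dots,T_g)$, $\gamma_j=\sum_{i=1}^g c_{ij}T_i$ for $1\le j\le f$, and let $H=H^g_{\mathfrak t}(S)=(T_1\cdots T_g)^{-1}R[T_1^{-1},\dots,T_g^{-1}]$. For $N=S$ or $N=H$ let $K_\bullet(\gamma,N)_\nu$ be the degree $\nu$ strand of the Koszul complex of $\gamma_1,\dots,\gamma_f$ with coefficients in $N$, so that $K_p(\gamma,N)_\nu=\bigwedge^p R^f\otimes_R N_{\nu-p}$. Let $\mathfrak B_\bullet(\Phi,\nu)$ be the $\nu$-th Buchsbaum–Eisenbud (generalized Koszul) complex of $\Phi$, $$0\to K_f(\gamma,H)_\nu\to\cdots\to K_{g+\nu+1}(\gamma,H)_\nu\to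 K_{g+\nu}(\gamma,H)_\nu\xrightarrow{\ \tau_\nu\ }K_\nu(\gamma,S)_\nu\to K_{\nu-1}(\gamma,S)_\nu\to\cdots\to K_0(\gamma,S)_\nu\to 0,$$ in which $K_0(\gamma,S)_\nu$ is in homological degree $0$ and $K_f(\gamma,H)_\nu$ in homological degree $f-g+1$. Here $\tau_\nu\colon\bigwedge^{g+\nu}R^f\otimes_R R\,(T_1\cdots T_g)^{-1}\to\bigwedge^\nu R^f$ is the contraction with the $g$ rows of $\Phi$ (as linear forms on $R^f$), i.e. $e_J\otimes (T_1\cdots T_g)^{-1}\mapsto\sum_{I\subseteq J,\ |I|=g}\pm\det(\Phi_I)\,e_{J\setminus I}$, where $\Phi_I$ is the submatrix of the columns in $I$. Put $\mathfrak B_\bullet(\Phi,L,\nu)=\mathfrak B_\bullet(\Phi,\nu)\otimes_R L$. Let $\operatorname{grade}_R(I,L)$ denote the supremum of the lengths of the $L$-regular sequences contained in the ideal $I$ (and $\infty$ if $IL=L$). Then $\mathfrak g:=\operatorname{grade}_R(I_g(\Phi),L)$ is finite, $$\mathfrak g=\min\{\,i : H_{f-g+1-i}(\mathfrak B_\bullet(\Phi,L,\nu))\neq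 0\,\},$$ and $$H_{f-g+1-\mathfrak g}(\mathfrak B_\bullet(\Phi,L,\nu))\;\cong\;\operatorname{Ext}^{\mathfrak g}_R\big(\operatorname{Sym}_R^{f-g-\nu}(M),L\big)$$ as $R$-modules. -/

import Mathlib

open scoped TensorProduct
open CategoryTheory

universe u

noncomputable section

namespace BuchsbaumEisenbud

variable {R : Type u} [CommRing R] {g f : ℕ}

/-- The cokernel `M` of the `g × f` matrix `Φ`, viewed as a map `R ^ f → R ^ g`. -/
abbrev Coker (Φ : Matrix (Fin g) (Fin f) R) : Type u :=
  (Fin g → R) ⧸ LinearMap.range Φ.mulVecLin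

/-- The ideal `I_g(Φ)` generated by the maximal (`g × g`) minors of `Φ`. -/
def minorsIdeal (Φ : Matrix (Fin g) (Fin f) R) : Ideal R :=
  Ideal.span (Set.range fun s : Fin g ↪o Fin f => (Φ.submatrix id s).det)

open Classical in
/-- The grade of `I` on `L`: the supremum of the lengths of `L`-regular sequences in `I` if
`I L ≠ L`, and `∞` if `I L = L`. -/
def grade (I : Ideal R) (L : Type u) [AddCommGroup L] [Module R L] : ℕ∞ :=
  if I • (⊤ : Submodule R L) = ⊤ then ⊤
  else ⨆ rs : {rs : List R // (∀ r ∈ rs, r ∈ I) ∧ RingTheory.Sequence.IsRegular L rs},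
    (rs.1.length : ℕ∞)

/-- The `n`-th symmetric power of `N`: the degree `n` component of the symmetric algebra. -/
abbrev SymPow (R : Type u) [CommRing R] (n : ℕ) (N : Type u) [AddCommGroup N] [Module R N] :
    Submodule R (SymmetricAlgebra R N) :=
  LinearMap.range (SymmetricAlgebra.ι R N) ^ n

section Contraction

theorem contractLeft_mem {N : Type u} [AddCommGroup N] [Module R N] (d : Module.Dual R N)
    (n : ℕ) (x : ExteriorAlgebra R N) (hx : x ∈ ⋀[R]^(n + 1) N) :
    CliffordAlgebra.contractLeft (Q := (0 : QuadraticForm R N)) d x ∈ ⋀[R]^n N := by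
  induction n generalizing x with
  | zero =>
    replace hx : x ∈ LinearMap.range (ExteriorAlgebra.ι R) ^ (0 + 1) := hx
    rw [zero_add, pow_one] at hx
    obtain ⟨m, rfl⟩ := hx
    change _ ∈ LinearMap.range (ExteriorAlgebra.ι R) ^ 0
    rw [pow_zero]
    exact Submodule.mem_one.mpr ⟨d m, (CliffordAlgebra.contractLeft_ι (Q := 0) d m).symm⟩
  | succ n ih =>
    replace hx : x ∈ LinearMap.range (ExteriorAlgebra.ι R) ^ (n + 1 + 1) := hx
    rw [pow_succ'] at hx
    induction hx using Submodule.mul_induction_on' with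
    | mem_mul_mem a ha b hb =>
      obtain ⟨m, rfl⟩ := ha
      have key := CliffordAlgebra.contractLeft_ι_mul (Q := (0 : QuadraticForm R N)) (d := d) m b
      refine (congrArg (· ∈ ⋀[R]^(n + 1) N) key).mpr ?_
      refine Submodule.sub_mem _ (Submodule.smul_mem _ _ hb) ?_
      change _ ∈ LinearMap.range (ExteriorAlgebra.ι R) ^ (n + 1)
      rw [pow_succ']
      exact Submodule.mul_mem_mul ⟨m, rfl⟩ (ih b hb)
    | add a _ b _ ha hb =>
      rw [map_add]
      exact Submodule.add_mem _ ha hb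

/-- The `i`-th row of `Φ` as a linear form on `R ^ f`. -/
def rowForm (Φ : Matrix (Fin g) (Fin f) R) (i : Fin g) : Module.Dual R (Fin f → R) :=
  LinearMap.proj i ∘ₗ Φ.mulVecLin

/-- Contraction with the `i`-th row of `Φ` on the exterior algebra of `R ^ f`. -/
def rowContr (Φ : Matrix (Fin g) (Fin f) R) (i : Fin g) :
    ExteriorAlgebra R (Fin f → R) →ₗ[R] ExteriorAlgebra R (Fin f → R) :=
  CliffordAlgebra.contractLeft (Q := (0 : QuadraticForm R (Fin f → R))) (rowForm Φ i)

theorem rowContr_self (Φ : Matrix (Fin g) (Fin f) R) (i : Fin g)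
    (x : ExteriorAlgebra R (Fin f → R)) : rowContr Φ i (rowContr Φ i x) = 0 :=
  CliffordAlgebra.contractLeft_contractLeft _ _

theorem rowContr_comm (Φ : Matrix (Fin g) (Fin f) R) (i j : Fin g)
    (x : ExteriorAlgebra R (Fin f → R)) :
    rowContr Φ i (rowContr Φ j x) = -rowContr Φ j (rowContr Φ i x) :=
  CliffordAlgebra.contractLeft_comm _ _ _

/-- The contraction `⋀^(p+1) R^f → ⋀^p R^f` with the `i`-th row of `Φ`. -/
def contr (Φ : Matrix (Fin g) (Fin f) R) (i : Fin g) (p : ℕ) :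
    ⋀[R]^(p + 1) (Fin f → R) →ₗ[R] ⋀[R]^p (Fin f → R) :=
  (rowContr Φ i).restrict (contractLeft_mem (rowForm Φ i) p)

theorem contr_self (Φ : Matrix (Fin g) (Fin f) R) (i : Fin g) (p : ℕ)
    (x : ⋀[R]^(p + 1 + 1) (Fin f → R)) : contr Φ i p (contr Φ i (p + 1) x) = 0 :=
  Subtype.ext (rowContr_self Φ i x.1)

theorem contr_comm (Φ : Matrix (Fin g) (Fin f) R) (i j : Fin g) (p : ℕ)
    (x : ⋀[R]^(p + 1 + 1) (Fin f → R)) :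
    contr Φ i p (contr Φ j (p + 1) x) = -contr Φ j p (contr Φ i (p + 1) x) :=
  Subtype.ext (rowContr_comm Φ i j x.1)

/-- The composite of the contractions with the rows listed in `l`. -/
def contrList (Φ : Matrix (Fin g) (Fin f) R) (l : List (Fin g)) :
    Module.End R (ExteriorAlgebra R (Fin f → R)) :=
  (l.map (rowContr Φ)).prod

theorem contrList_mem (Φ : Matrix (Fin g) (Fin f) R) (l : List (Fin g)) (p : ℕ)
    (x : ExteriorAlgebra R (Fin f → R)) (hx : x ∈ ⋀[R]^(l.length + p) (Fin f → R)) :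
    contrList Φ l x ∈ ⋀[R]^p (Fin f → R) := by
  induction l generalizing p with
  | nil => simpa [contrList] using hx
  | cons i l ih =>
    rw [List.length_cons, add_assoc, add_comm 1 p] at hx
    have hcons : contrList Φ (i :: l) x = rowContr Φ i (contrList Φ l x) := by simp [contrList]
    rw [hcons]
    exact contractLeft_mem (rowForm Φ i) p _ (ih (p + 1) hx)

/-- The contraction `⋀^(g+p) R^f → ⋀^p R^f` with all the `g` rows of `Φ`. On basis elements it is
`e_J ↦ ∑ ± det(Φ_I) e_(J∖I)`, the sum being over the `g`-element subsets `I` of `J`. -/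
def contrAll (Φ : Matrix (Fin g) (Fin f) R) (p : ℕ) :
    ⋀[R]^(g + p) (Fin f → R) →ₗ[R] ⋀[R]^p (Fin f → R) :=
  (contrList Φ (List.finRange g)).restrict
    fun x hx => contrList_mem Φ (List.finRange g) p x (by rwa [List.length_finRange])

theorem contrList_rowContr (Φ : Matrix (Fin g) (Fin f) R) (l : List (Fin g)) (i : Fin g)
    (hi : i ∈ l) (x : ExteriorAlgebra R (Fin f → R)) : contrList Φ l (rowContr Φ i x) = 0 := by
  induction l generalizing x with
  | nil => simp at hi
  | cons j l ih =>
    have hcons : ∀ y, contrList Φ (j :: l) y = rowContr Φ j (contrList Φ l y) := fun y => by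
      simp [contrList]
    have hanti : ∀ (m : List (Fin g)) (y : ExteriorAlgebra R (Fin f → R)),
        contrList Φ m (rowContr Φ i y) = rowContr Φ i (contrList Φ m y) ∨
        contrList Φ m (rowContr Φ i y) = -rowContr Φ i (contrList Φ m y) := by
      intro m
      induction m with
      | nil => intro y; left; simp [contrList]
      | cons k m ihm =>
        intro y
        have hk : ∀ y, contrList Φ (k :: m) y = rowContr Φ k (contrList Φ m y) := fun y => by
          simp [contrList]
        rw [hk, hk]
        rcases ihm y with h | h
        · right; rw [h, rowContr_comm]
        · left; rw [h, map_neg, rowContr_comm, neg_neg]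
    rw [hcons]
    rcases List.mem_cons.mp hi with rfl | hil
    · rcases hanti l x with h | h
      · rw [h, rowContr_self]
      · rw [h, map_neg, rowContr_self, neg_zero]
    · rw [ih hil, map_zero]

theorem rowContr_contrList (Φ : Matrix (Fin g) (Fin f) R) (l : List (Fin g)) (i : Fin g)
    (hi : i ∈ l) (x : ExteriorAlgebra R (Fin f → R)) : rowContr Φ i (contrList Φ l x) = 0 := by
  induction l with
  | nil => simp at hi
  | cons j l ih =>
    have hcons : contrList Φ (j :: l) x = rowContr Φ j (contrList Φ l x) := by
      simp [contrList]
    rw [hcons]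
    rcases List.mem_cons.mp hi with rfl | hil
    · exact rowContr_self _ _ _
    · rw [rowContr_comm, ih hil, map_zero, neg_zero]

end Contraction

section Graded

/-- The graded component `S_(ν - k)` of `S = R[T_1, …, T_g]` (zero if `k > ν`). -/
def polyComp (R : Type u) [CommRing R] (g ν k : ℕ) : Submodule R (MvPolynomial (Fin g) R) :=
  MvPolynomial.restrictSupport R {a | a.degree + k = ν}

/-- Multiplication by `T_i` from degree `ν - (k + 1)` to degree `ν - k`. -/
def mulT (R : Type u) [CommRing R] {g : ℕ} (i : Fin g) (ν k : ℕ) :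
    polyComp R g ν (k + 1) →ₗ[R] polyComp R g ν k :=
  (LinearMap.mulLeft R (MvPolynomial.X i : MvPolynomial (Fin g) R)).restrict (by
    intro p hp a ha
    rw [LinearMap.mulLeft_apply, Finset.mem_coe] at ha
    have ha' : a ∈ (MvPolynomial.X i * p).support := ha
    rw [MvPolynomial.support_X_mul, Finset.mem_map] at ha'
    obtain ⟨b, hb, rfl⟩ := ha'
    have := hp hb
    simp only [Set.mem_ofPred_eq, addLeftEmbedding_apply, map_add,
      Finsupp.degree_single] at this ⊢
    omega)

theorem mulT_comm (i j : Fin g) (ν k : ℕ) (y : polyComp R g ν (k + 1 + 1)) :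
    mulT R i ν k (mulT R j ν (k + 1) y) = mulT R j ν k (mulT R i ν (k + 1) y) :=
  Subtype.ext (mul_left_comm (MvPolynomial.X i) (MvPolynomial.X j) y.1)

/-- The top local cohomology module `H^g_(T_1,…,T_g)(S) = (T_1 ⋯ T_g)⁻¹ R[T_1⁻¹, …, T_g⁻¹]`, the
free `R`-module on the inverse monomials: the exponent `b ∈ ℕ ^ g` stands for
`T_1 ^ (-b_1 - 1) ⋯ T_g ^ (-b_g - 1)`, which has degree `- |b| - g`. -/
abbrev InvPoly (R : Type u) [CommRing R] (g : ℕ) : Type u := (Fin g →₀ ℕ) →₀ R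

/-- Multiplication by `T_i` on inverse polynomials. It takes the inverse monomial with exponent `b`
to that with exponent `b - e_i`, or to zero if `b_i = 0`. -/
def invMulT (R : Type u) [CommRing R] {g : ℕ} (i : Fin g) : InvPoly R g →ₗ[R] InvPoly R g :=
  Finsupp.lcomapDomain (fun b => b + Finsupp.single i 1) (add_left_injective _)

/-- The graded component of degree `ν - (g + k)` of `H^g_(T_1,…,T_g)(S)`, i.e. the span of the
inverse monomials with exponents `b` such that `- |b| - g = ν - (g + k)` (zero if `k < ν`). -/
def invComp (R : Type u) [CommRing R] (g ν k : ℕ) : Submodule R (InvPoly R g) :=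
  Finsupp.supported R R {b | b.degree + ν = k}

/-- Multiplication by `T_i` from degree `ν - (g + k + 1)` to degree `ν - (g + k)`. -/
def invCompMulT (R : Type u) [CommRing R] {g : ℕ} (i : Fin g) (ν k : ℕ) :
    invComp R g ν (k + 1) →ₗ[R] invComp R g ν k :=
  (invMulT R i).restrict (by
    intro h hh a ha
    have h1 : h (a + Finsupp.single i 1) ≠ 0 := by simpa [invMulT] using ha
    have h2 := hh (Finsupp.mem_support_iff.mpr h1)
    simp only [Set.mem_ofPred_eq, map_add, Finsupp.degree_single] at h2 ⊢
    omega)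

theorem invCompMulT_comm (i j : Fin g) (ν k : ℕ) (y : invComp R g ν (k + 1 + 1)) :
    invCompMulT R i ν k (invCompMulT R j ν (k + 1) y) =
      invCompMulT R j ν k (invCompMulT R i ν (k + 1) y) := by
  refine Subtype.ext (Finsupp.ext fun a => ?_)
  change y.1 (a + Finsupp.single i 1 + Finsupp.single j 1) =
    y.1 (a + Finsupp.single j 1 + Finsupp.single i 1)
  exact congrArg y.1 (add_right_comm _ _ _)

/-- The map `H^g_(T_1,…,T_g)(S) → S` taking `(T_1 ⋯ T_g)⁻¹` to `1` and all the other inverse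
monomials to zero, in degrees `ν - (g + k)` and `ν - k`; it is nonzero only for `k = ν`. -/
def residue (R : Type u) [CommRing R] (g ν k : ℕ) :
    invComp R g ν k →ₗ[R] polyComp R g ν k :=
  ((Algebra.linearMap R (MvPolynomial (Fin g) R)) ∘ₗ Finsupp.lapply 0).restrict (by
    intro h hh a ha
    have h0 : MvPolynomial.coeff a (MvPolynomial.C (h 0) : MvPolynomial (Fin g) R) ≠ 0 :=
      MvPolynomial.mem_support_iff.mp ha
    rw [MvPolynomial.coeff_C] at h0
    split_ifs at h0 with h1
    · subst h1
      have h2 := hh (Finsupp.mem_support_iff.mpr h0)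
      simp only [Set.mem_ofPred_eq, map_zero] at h2 ⊢
      omega
    · exact absurd rfl h0)

end Graded

section Complex

/-- The degree `ν` component of `K_k(γ, S) = ⋀^k R^f ⊗ S(-k)`. -/
abbrev KS (R : Type u) [CommRing R] (g f ν k : ℕ) : Type u :=
  ⋀[R]^k (Fin f → R) ⊗[R] polyComp R g ν k

/-- The degree `ν` component of `K_(g+k)(γ, H) = ⋀^(g+k) R^f ⊗ H(-g-k)`, where `H` is the top local
cohomology module of `S`. -/
abbrev KH (R : Type u) [CommRing R] (g f ν k : ℕ) : Type u :=
  ⋀[R]^(g + k) (Fin f → R) ⊗[R] invComp R g ν k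

variable (Φ : Matrix (Fin g) (Fin f) R)

/-- The Koszul differential on `K(γ, S)`, where `γ_j = ∑ i, Φ i j * T_i`, in degree `ν`; it takes
`e_j` to `γ_j`, hence is the sum over `i` of (contraction with the `i`-th row of `Φ`) `⊗ T_i`. -/
def dS (ν k : ℕ) : KS R g f ν (k + 1) →ₗ[R] KS R g f ν k :=
  ∑ i : Fin g, TensorProduct.map (contr Φ i k) (mulT R i ν k)

/-- The Koszul differential on `K(γ, H)` in degree `ν`. -/
def dH (ν k : ℕ) : KH R g f ν (k + 1) →ₗ[R] KH R g f ν k :=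
  ∑ i : Fin g, TensorProduct.map (contr Φ i (g + k)) (invCompMulT R i ν k)

/-- The splicing map `τ` from `K_(g+ν)(γ, H)_ν = ⋀^(g+ν) R^f` to `K_ν(γ, S)_ν = ⋀^ν R^f`, i.e. the
contraction with the exterior product of the rows of `Φ` (it is zero for `k ≠ ν`). -/
def splice (ν k : ℕ) : KH R g f ν k →ₗ[R] KS R g f ν k :=
  TensorProduct.map (contrAll Φ k) (residue R g ν k)

theorem anti_sum_zero {N P : Type u} [AddCommGroup N] [AddCommGroup P] [Module R N] [Module R P]
    (F : Fin g → Fin g → N) (G : Fin g → Fin g → P) (hF0 : ∀ i, F i i = 0)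
    (hF : ∀ i j, F i j = -F j i) (hG : ∀ i j, G i j = G j i) :
    ∑ i, ∑ j, F i j ⊗ₜ[R] G i j = 0 := by
  rw [← Finset.sum_product']
  refine Finset.sum_involution (fun p _ => (p.2, p.1)) ?_ ?_ (fun _ _ => by simp)
    (fun _ _ => rfl)
  · rintro ⟨i, j⟩ -
    rw [hF i j, hG i j, TensorProduct.neg_tmul, neg_add_cancel]
  · rintro ⟨i, j⟩ - h0 heq
    obtain rfl : j = i := congrArg Prod.fst heq
    exact h0 (by rw [hF0, TensorProduct.zero_tmul])

theorem dS_comp_dS (ν k : ℕ) : dS Φ ν k ∘ₗ dS Φ ν (k + 1) = 0 := by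
  refine TensorProduct.ext' fun x y => ?_
  simp only [dS, LinearMap.comp_apply, LinearMap.sum_apply, TensorProduct.map_tmul, map_sum,
    LinearMap.zero_apply]
  rw [Finset.sum_comm]
  exact anti_sum_zero (fun i j => contr Φ i k (contr Φ j (k + 1) x))
    (fun i j => mulT R i ν k (mulT R j ν (k + 1) y))
    (fun i => contr_self Φ i k x) (fun i j => contr_comm Φ i j k x)
    (fun i j => mulT_comm i j ν k y)

theorem dH_comp_dH (ν k : ℕ) : dH Φ ν k ∘ₗ dH Φ ν (k + 1) = 0 := by
  refine TensorProduct.ext' fun x y => ?_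
  simp only [dH, LinearMap.comp_apply, LinearMap.sum_apply, TensorProduct.map_tmul, map_sum,
    LinearMap.zero_apply]
  rw [Finset.sum_comm]
  exact anti_sum_zero (fun i j => contr Φ i (g + k) (contr Φ j (g + k + 1) x))
    (fun i j => invCompMulT R i ν k (invCompMulT R j ν (k + 1) y))
    (fun i => contr_self Φ i (g + k) x) (fun i j => contr_comm Φ i j (g + k) x)
    (fun i j => invCompMulT_comm i j ν k y)

theorem dS_comp_splice (ν k : ℕ) : dS Φ ν k ∘ₗ splice Φ ν (k + 1) = 0 := by
  refine TensorProduct.ext' fun x y => ?_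
  simp only [dS, splice, LinearMap.comp_apply, LinearMap.sum_apply, TensorProduct.map_tmul,
    LinearMap.zero_apply]
  refine Finset.sum_eq_zero fun i _ => ?_
  have : contr Φ i k (contrAll Φ (k + 1) x) = 0 :=
    Subtype.ext (rowContr_contrList Φ _ i (List.mem_finRange i) _)
  rw [this, TensorProduct.zero_tmul]

theorem splice_comp_dH (ν k : ℕ) : splice Φ ν k ∘ₗ dH Φ ν k = 0 := by
  refine TensorProduct.ext' fun x y => ?_
  simp only [dH, splice, LinearMap.comp_apply, LinearMap.sum_apply, TensorProduct.map_tmul,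
    LinearMap.zero_apply, map_sum]
  refine Finset.sum_eq_zero fun i _ => ?_
  have : contrAll Φ k (contr Φ i (g + k) x) = 0 :=
    Subtype.ext (contrList_rowContr Φ _ i (List.mem_finRange i) _)
  rw [this, TensorProduct.zero_tmul]

/-- The modules of the complex `𝔅(Φ, ν)`: one has `KS R g f ν k = 0` for `k > ν` and
`KH R g f ν k = 0` for `k < ν`, hence `𝔅_k = K_k(γ, S)_ν` for `k ≤ ν` and
`𝔅_(k+1) = K_(g+k)(γ, H)_ν` for `k ≥ ν`. -/
def complexX (R : Type u) [CommRing R] (g f ν : ℕ) : ℕ → ModuleCat.{u} R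
  | 0 => ModuleCat.of R (KS R g f ν 0)
  | k + 1 => ModuleCat.of R (KS R g f ν (k + 1) × KH R g f ν k)

/-- The differentials of the complex `𝔅(Φ, ν)`: those of `K(γ, S)_ν` and of `K(γ, H)_ν`, spliced
by `τ` (from position `ν + 1` to position `ν`). -/
def complexD (ν : ℕ) : (k : ℕ) → (complexX R g f ν (k + 1) ⟶ complexX R g f ν k)
  | 0 => ModuleCat.ofHom ((dS Φ ν 0).coprod (splice Φ ν 0))
  | k + 1 => ModuleCat.ofHom
      (((dS Φ ν (k + 1)).coprod (splice Φ ν (k + 1))).prod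
        (dH Φ ν k ∘ₗ LinearMap.snd R (KS R g f ν (k + 2)) (KH R g f ν (k + 1))))

theorem complexD_comp (ν k : ℕ) : complexD Φ ν (k + 1) ≫ complexD Φ ν k = 0 := by
  have h1 : ∀ j x, dS Φ ν j (dS Φ ν (j + 1) x) = 0 := fun j x =>
    LinearMap.congr_fun (dS_comp_dS Φ ν j) x
  have h2 : ∀ j x, dH Φ ν j (dH Φ ν (j + 1) x) = 0 := fun j x =>
    LinearMap.congr_fun (dH_comp_dH Φ ν j) x
  have h3 : ∀ j x, dS Φ ν j (splice Φ ν (j + 1) x) = 0 := fun j x =>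
    LinearMap.congr_fun (dS_comp_splice Φ ν j) x
  have h4 : ∀ j x, splice Φ ν j (dH Φ ν j x) = 0 := fun j x =>
    LinearMap.congr_fun (splice_comp_dH Φ ν j) x
  cases k with
  | zero =>
    refine ModuleCat.hom_ext (LinearMap.ext fun x => ?_)
    obtain ⟨a, b⟩ : KS R g f ν 2 × KH R g f ν 1 := x
    change dS Φ ν 0 (dS Φ ν 1 a + splice Φ ν 1 b) + splice Φ ν 0 (dH Φ ν 0 b) = 0
    rw [map_add, h1, h3, h4, add_zero, add_zero]
  | succ k =>
    refine ModuleCat.hom_ext (LinearMap.ext fun x => ?_)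
    obtain ⟨a, b⟩ : KS R g f ν (k + 3) × KH R g f ν (k + 2) := x
    change (dS Φ ν (k + 1) (dS Φ ν (k + 2) a + splice Φ ν (k + 2) b) +
      splice Φ ν (k + 1) (dH Φ ν (k + 1) b), dH Φ ν k (dH Φ ν (k + 1) b)) = 0
    rw [map_add, h1, h3, h4, h2, add_zero, add_zero]
    rfl

/-- The complex `𝔅(Φ, ν)`, i.e. the `ν`-th Buchsbaum–Eisenbud complex (generalized Koszul complex)
of `Φ`. -/
def complex (ν : ℕ) : ChainComplex (ModuleCat.{u} R) ℕ :=
  ChainComplex.of (complexX R g f ν) (complexD Φ ν) (complexD_comp Φ ν)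

/-- The complex `𝔅(Φ, L, ν) = 𝔅(Φ, ν) ⊗ L`. -/
def complexTensor (L : Type u) [AddCommGroup L] [Module R L] (ν : ℕ) :
    ChainComplex (ModuleCat.{u} R) ℕ :=
  ((MonoidalCategory.tensorRight (ModuleCat.of R L)).mapHomologicalComplex
    (ComplexShape.down ℕ)).obj (complex Φ ν)

end Complex

end BuchsbaumEisenbud

end

/-! Write `N` for the symmetric power of degree `f - g - ν` of the cokernel `M`, and `F n L` for the
homology of the complex with coefficients in `L` in position `f - g + 1 - n`. The proof shows that
`F` shares with `Ext^n(N, -)` the few formal properties that determine the first nonvanishing value.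

The top homology is a kernel, since nothing lies above it. Inverse polynomials are dual to
polynomials, so this kernel is the `L`-dual of the presentation `S_(t-1)^f → S_t → Sym^t M → 0` with
`t = f - g - ν`; hence `F 0 L = Hom(N, L)` (`nonempty_topHomology_equiv`).

For each maximal minor `δ` there is `B` with `Φ B = δ`. Exterior multiplication by the columns of
`B`, combined with division by the variables, yields a null homotopy of `δ ^ g` on the whole spliced
complex (`totalD_totalHomotopy`). So the ideal `J` of `g`-th powers of minors kills every `F n L`
(`smul_homology_complexTensor`). It also kills `M`, hence `N`, because `t > 0`; so it kills
`Ext^n(N, L)`.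

The terms of the complex are flat, so `0 → L → L → L/xL → 0` induces long exact sequences for both
functors. If `x` in `J` is `L`-regular, they give `F n (L/xL) ≅ F (n + 1) L` as soon as `F n L = 0`.
These properties form `IsShiftSequence`. For a weakly regular sequence `rs` in `J` of length `m`,
they imply `F i L = 0` for `i < m` and `F m L ≅ Hom(N, L/(rs)L)`, and likewise for `Ext`.

Finally take `rs` maximal in `J`. Then `L/(rs)L` contains a copy of `R/p` for a prime `p ⊇ J`. Such
a `p` contains the minors, so `Hom(N, R/p) ≠ 0` and `F m L ≠ 0`. The vanishing half also holds for
sequences in the radical of `J`, which contains all minors, so no regular sequence in `I_g(Φ)` is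
longer than `m`; thus `m` is the grade. -/

namespace BuchsbaumEisenbud

noncomputable section

/-! ### Combining partial homotopies, one for each variable -/

section ListHomotopy

variable {A ι : Type*} [Ring A]

/-- Given operators `s i` with `d * s i + s i * d = δ - e i`, an operator `s` with
`d * s + s * d = δ ^ l.length - ∏ e i`. -/
def listHomotopy (δ : A) (s e : ι → A) : List ι → A
  | [] => 0
  | i :: l => δ ^ l.length * s i + e i * listHomotopy δ s e l

/-- The sum telescopes: `δ ^ n (δ - e i) + e i (δ ^ n - P) = δ ^ (n + 1) - e i P`. The factor `e i`
can be pulled out because it commutes with `d`, being `δ` minus a null-homotopic operator. -/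
theorem listHomotopy_spec {d δ : A} {s e : ι → A} (hd : d * d = 0) (hδ : ∀ a, Commute δ a)
    (h : ∀ i, d * s i + s i * d = δ - e i) (l : List ι) :
    d * listHomotopy δ s e l + listHomotopy δ s e l * d = δ ^ l.length - (l.map e).prod := by
  have he : ∀ i, d * e i = e i * d := by
    intro i
    have h1 : e i = δ - (d * s i + s i * d) := by rw [h]; abel
    have h2 : d * (d * s i) = 0 := by rw [← mul_assoc, hd, zero_mul]
    have h3 : s i * d * d = 0 := by rw [mul_assoc, hd, mul_zero]
    rw [h1, mul_sub, sub_mul, mul_add, add_mul, h2, h3, (hδ d).eq]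
    noncomm_ring
  induction l with
  | nil => simp [listHomotopy]
  | cons i l ih =>
    simp only [listHomotopy, List.length_cons, List.map_cons, List.prod_cons]
    have hc : d * δ ^ l.length = δ ^ l.length * d := ((hδ d).pow_left _).eq.symm
    calc _ = δ ^ l.length * (d * s i + s i * d) +
          e i * (d * listHomotopy δ s e l + listHomotopy δ s e l * d) := by
            rw [mul_add, add_mul, ← mul_assoc, hc, ← mul_assoc, he i]
            noncomm_ring
      _ = _ := by
        rw [h, ih, mul_sub, mul_sub, ((hδ (e i)).pow_left _).eq, pow_succ]
        noncomm_ring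

end ListHomotopy

/-! ### Reordering products of anticommuting operators -/

section Clifford

variable {A ι : Type*} [Ring A]

theorem mul_comm_of_anticomm {a b x : A} (ha : x * a = -(a * x)) (hb : x * b = -(b * x)) :
    x * (a * b) = a * b * x := by
  rw [← mul_assoc, ha, neg_mul, mul_assoc, hb]
  noncomm_ring

theorem commute_list_prod {x : A} (l : List ι) (F : ι → A)
    (h : ∀ i ∈ l, x * F i = F i * x) : x * (l.map F).prod = (l.map F).prod * x := by
  induction l with
  | nil => simp
  | cons i l ih =>
    rw [List.map_cons, List.prod_cons, ← mul_assoc, h i List.mem_cons_self, mul_assoc,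
      ih fun j hj => h j (List.mem_cons_of_mem _ hj), mul_assoc]

/-- Each pair `c j * w j` is even, so `w i` passes through all the pairs with `j ≠ i` without a
sign. Listing the `w` in reverse order is what avoids a global sign. Together with
`prod_reverse_mul_prod` this identifies the product of the defects with the two composites of the
splicing map and its reverse. -/
theorem prod_mul_prod_reverse (c w : ι → A) (hww : ∀ i j, w i * w j = -(w j * w i))
    (hcw : ∀ i j, i ≠ j → c i * w j = -(w j * c i)) (l : List ι) (hl : l.Nodup) :
    (l.map c).prod * (l.reverse.map w).prod = (l.map fun i => c i * w i).prod := by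
  induction l with
  | nil => simp
  | cons i l ih =>
    obtain ⟨hi, hl'⟩ := List.nodup_cons.mp hl
    have key : w i * (l.map fun j => c j * w j).prod = (l.map fun j => c j * w j).prod * w i := by
      refine commute_list_prod l _ fun j hj => mul_comm_of_anticomm ?_ (hww i j)
      rw [hcw j i (fun e => hi (e ▸ hj)), neg_neg]
    simp only [List.map_cons, List.prod_cons, List.reverse_cons, List.map_append, List.map_nil,
      List.prod_append, List.prod_nil, mul_one]
    rw [mul_assoc (c i), ← mul_assoc _ _ (w i), ih hl', ← key, mul_assoc]

theorem prod_reverse_mul_prod (c w : ι → A) (hww : ∀ i j, w i * w j = -(w j * w i))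
    (hcw : ∀ i j, i ≠ j → c i * w j = -(w j * c i)) (l : List ι) (hl : l.Nodup) :
    (l.reverse.map w).prod * (l.map c).prod = (l.map fun i => w i * c i).prod := by
  induction l with
  | nil => simp
  | cons i l ih =>
    obtain ⟨hi, hl'⟩ := List.nodup_cons.mp hl
    have key : w i * c i * (l.reverse.map w).prod = (l.reverse.map w).prod * (w i * c i) := by
      refine commute_list_prod l.reverse _ fun j hj => ?_
      refine (mul_comm_of_anticomm (hww j i) ?_).symm
      rw [hcw i j (fun e => hi (by simpa [e] using hj)), neg_neg]
    simp only [List.map_cons, List.prod_cons, List.reverse_cons, List.map_append, List.map_nil,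
      List.prod_append, List.prod_nil, mul_one]
    rw [mul_assoc, ← mul_assoc (w i), ← mul_assoc, ← key, mul_assoc, ih hl']

end Clifford

/-! ### Koszul-type operators on tensor products and their homotopies -/

section KoszulOperators

variable {R : Type u} [CommRing R] {V N : Type u} [AddCommGroup V] [Module R V] [AddCommGroup N]
  [Module R N] {ι : Type*}

/-- The operator `∑ i, c i ⊗ T i`. -/
def koszulOp [Fintype ι] (c : ι → Module.End R V) (T : ι → Module.End R N) : Module.End R (V ⊗[R] N) :=
  ∑ i, TensorProduct.map (c i) (T i)

theorem koszulOp_mul_self {g : ℕ} (c : Fin g → Module.End R V) (T : Fin g → Module.End R N)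
    (hc0 : ∀ i, c i * c i = 0) (hc : ∀ i j, c i * c j = -(c j * c i))
    (hT : ∀ i j, T i * T j = T j * T i) : koszulOp c T * koszulOp c T = 0 := by
  refine TensorProduct.ext' fun x y => ?_
  simp only [koszulOp, Module.End.mul_apply, LinearMap.sum_apply, TensorProduct.map_tmul,
    map_sum, LinearMap.zero_apply]
  rw [Finset.sum_comm]
  exact anti_sum_zero (fun i j => c i (c j x)) (fun i j => T i (T j y))
    (fun i => LinearMap.congr_fun (hc0 i) x) (fun i j => LinearMap.congr_fun (hc i j) x)
    (fun i j => LinearMap.congr_fun (hT i j) y)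

/-- The defect of the homotopy `w i ⊗ P i` on `koszulOp c T`. -/
def defect (c w : ι → Module.End R V) (T P : ι → Module.End R N) (i : ι) :
    Module.End R (V ⊗[R] N) :=
  TensorProduct.map (c i * w i) (1 - T i * P i) + TensorProduct.map (w i * c i) (1 - P i * T i)

/-- For `j ≠ i` the summands cancel, as `c j` and `w i` anticommute while `T j` and `P i` commute.
For `j = i` one would get `δ` if `T i` and `P i` were inverse to each other; `defect` measures their
failure to be so. -/
theorem koszulOp_homotopy [Fintype ι] [DecidableEq ι] (δ : R) (c w : ι → Module.End R V)
    (T P : ι → Module.End R N)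
    (hcw : ∀ i j, c i * w j + w j * c i = if i = j then algebraMap R _ δ else 0)
    (hTP : ∀ i j, i ≠ j → T i * P j = P j * T i) (i : ι) :
    koszulOp c T * TensorProduct.map (w i) (P i) + TensorProduct.map (w i) (P i) * koszulOp c T =
      algebraMap R _ δ - defect c w T P i := by
  have h1 : koszulOp c T * TensorProduct.map (w i) (P i) +
      TensorProduct.map (w i) (P i) * koszulOp c T =
      ∑ j, (TensorProduct.map (c j * w i) (T j * P i) +
        TensorProduct.map (w i * c j) (P i * T j)) := by
    simp only [koszulOp, Finset.sum_mul, Finset.mul_sum, ← TensorProduct.map_mul,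
      Finset.sum_add_distrib]
  rw [h1, Finset.sum_eq_single i]
  · rw [defect, eq_sub_iff_add_eq]
    have h2 : (TensorProduct.map (c i * w i) (T i * P i) +
        TensorProduct.map (w i * c i) (P i * T i)) +
        (TensorProduct.map (c i * w i) (1 - T i * P i) +
          TensorProduct.map (w i * c i) (1 - P i * T i)) =
        TensorProduct.map (c i * w i + w i * c i) (1 : Module.End R N) := by
      rw [add_add_add_comm, ← TensorProduct.map_add_right, ← TensorProduct.map_add_right,
        add_sub_cancel, add_sub_cancel, ← TensorProduct.map_add_left]
    rw [h2, hcw, if_pos rfl]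
    ext x y
    simp [Module.algebraMap_end_apply, TensorProduct.smul_tmul']
  · intro j _ hj
    rw [hTP j i hj, ← TensorProduct.map_add_left, hcw, if_neg hj, TensorProduct.map_zero_left]
  · simp

theorem list_prod_map_map (l : List ι) (a : ι → Module.End R V) (b : ι → Module.End R N) :
    (l.map fun i => TensorProduct.map (a i) (b i)).prod =
      TensorProduct.map (l.map a).prod (l.map b).prod := by
  induction l with
  | nil => simp
  | cons i l ih => simp only [List.map_cons, List.prod_cons, ih, TensorProduct.map_mul]

end KoszulOperators

/-! ### Multiplication and division by variables on polynomials and inverse polynomials -/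

section Monomials

variable (R : Type u) [CommRing R] {g : ℕ}

/-- Multiplication by `T_i` on polynomials. -/
def polyT (i : Fin g) : Module.End R (MvPolynomial (Fin g) R) :=
  LinearMap.mulLeft R (MvPolynomial.X i)

/-- Division by `T_i` on polynomials, dropping the monomials that `T_i` does not divide. -/
def polyP (i : Fin g) : Module.End R (MvPolynomial (Fin g) R) where
  toFun p := p.divMonomial (Finsupp.single i 1)
  map_add' p q := MvPolynomial.add_divMonomial p q _
  map_smul' r p := by ext a; simp [MvPolynomial.coeff_divMonomial]

/-- Division by `T_i` on inverse polynomials. -/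
def invP (i : Fin g) : Module.End R (InvPoly R g) :=
  Finsupp.lmapDomain R R (· + Finsupp.single i 1)

/-- The constant coefficient of a polynomial, as a multiple of `(T_1 ⋯ T_g)⁻¹`. -/
def coresidue (g : ℕ) : MvPolynomial (Fin g) R →ₗ[R] InvPoly R g :=
  Finsupp.lsingle 0 ∘ₗ MvPolynomial.lcoeff R 0

/-- The coefficient of `(T_1 ⋯ T_g)⁻¹` of an inverse polynomial, as a constant polynomial. -/
def residueTotal (g : ℕ) : InvPoly R g →ₗ[R] MvPolynomial (Fin g) R :=
  (Algebra.linearMap R (MvPolynomial (Fin g) R)) ∘ₗ Finsupp.lapply 0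

variable {R}

theorem coeff_polyP (i : Fin g) (p : MvPolynomial (Fin g) R) (a : Fin g →₀ ℕ) :
    (polyP R i p).coeff a = p.coeff (Finsupp.single i 1 + a) :=
  MvPolynomial.coeff_divMonomial _ _ _

theorem coeff_polyT (i : Fin g) (p : MvPolynomial (Fin g) R) (a : Fin g →₀ ℕ) :
    (polyT R i p).coeff a = if a i = 0 then 0 else p.coeff (a - Finsupp.single i 1) := by
  rw [polyT, LinearMap.mulLeft_apply, MvPolynomial.coeff_X_mul']
  simp

theorem polyT_comm (i j : Fin g) : polyT R i * polyT R j = polyT R j * polyT R i :=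
  LinearMap.ext fun p => mul_left_comm (MvPolynomial.X i) (MvPolynomial.X j) p

theorem polyP_mul_polyT (i : Fin g) : polyP R i * polyT R i = 1 :=
  LinearMap.ext fun p => MvPolynomial.X_mul_divMonomial i p

theorem polyT_mul_polyP (i j : Fin g) (hij : i ≠ j) :
    polyT R i * polyP R j = polyP R j * polyT R i := by
  refine LinearMap.ext fun p => MvPolynomial.ext _ _ fun a => ?_
  simp only [Module.End.mul_apply, coeff_polyP, coeff_polyT]
  have h0 : (Finsupp.single j 1 + a : Fin g →₀ ℕ) i = a i := by
    simp [Finsupp.single_eq_of_ne hij]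
  rw [h0]
  split_ifs with h
  · rfl
  · rw [add_tsub_assoc_of_le]
    simpa [Nat.one_le_iff_ne_zero] using h

theorem coeff_one_sub_polyT_polyP (i : Fin g) (p : MvPolynomial (Fin g) R) (a : Fin g →₀ ℕ) :
    ((1 - polyT R i * polyP R i) p).coeff a = if a i = 0 then p.coeff a else 0 := by
  rw [LinearMap.sub_apply, MvPolynomial.coeff_sub, Module.End.mul_apply, coeff_polyT]
  split_ifs with h
  · simp
  · rw [coeff_polyP, add_tsub_cancel_of_le, Module.End.one_apply, sub_self]
    simpa [Nat.one_le_iff_ne_zero] using h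

theorem invMulT_apply (i : Fin g) (h : InvPoly R g) (b : Fin g →₀ ℕ) :
    invMulT R i h b = h (b + Finsupp.single i 1) := rfl

theorem invP_apply (i : Fin g) (h : InvPoly R g) (b : Fin g →₀ ℕ) :
    invP R i h b = if b i = 0 then 0 else h (b - Finsupp.single i 1) := by
  split_ifs with hb
  · refine Finsupp.mapDomain_of_notMem_range _ _ ?_
    rintro ⟨a, rfl⟩
    simp at hb
  · have : b = (b - Finsupp.single i 1) + Finsupp.single i 1 := by
      rw [tsub_add_cancel_of_le]
      simpa [Nat.one_le_iff_ne_zero] using hb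
    conv_lhs => rw [this]
    exact Finsupp.mapDomain_apply (add_left_injective _) _ _

theorem invMulT_mul_comm (i j : Fin g) :
    invMulT R i * invMulT R j = invMulT R j * invMulT R i :=
  LinearMap.ext fun h => Finsupp.ext fun b =>
    congrArg h (add_right_comm b (Finsupp.single i 1) (Finsupp.single j 1))

theorem invMulT_mul_invP_self (i : Fin g) :
    (invMulT R i * invP R i : Module.End R (InvPoly R g)) = 1 := by
  refine LinearMap.ext fun h => Finsupp.ext fun b => ?_
  rw [Module.End.mul_apply, invMulT_apply, invP_apply]
  simp

theorem invMulT_mul_invP (i j : Fin g) (hij : i ≠ j) :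
    invMulT R i * invP R j = invP R j * invMulT R i := by
  refine LinearMap.ext fun h => Finsupp.ext fun b => ?_
  simp only [Module.End.mul_apply, invMulT_apply, invP_apply]
  have h0 : (b + Finsupp.single i 1 : Fin g →₀ ℕ) j = b j := by
    simp [Finsupp.single_eq_of_ne hij.symm]
  rw [h0]
  split_ifs with hb
  · rfl
  · rw [tsub_add_eq_add_tsub]
    simpa [Nat.one_le_iff_ne_zero] using hb

theorem one_sub_invP_invMulT_apply (i : Fin g) (h : InvPoly R g) (b : Fin g →₀ ℕ) :
    (1 - invP R i * invMulT R i) h b = if b i = 0 then h b else 0 := by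
  rw [LinearMap.sub_apply, Finsupp.sub_apply, Module.End.mul_apply, invP_apply]
  split_ifs with hb
  · simp
  · rw [invMulT_apply, tsub_add_cancel_of_le, Module.End.one_apply, sub_self]
    simpa [Nat.one_le_iff_ne_zero] using hb

theorem coresidue_apply (p : MvPolynomial (Fin g) R) (b : Fin g →₀ ℕ) :
    coresidue R g p b = if b = 0 then p.coeff 0 else 0 := by
  simp [coresidue, Finsupp.single_apply, eq_comm]

theorem coeff_residueTotal (h : InvPoly R g) (a : Fin g →₀ ℕ) :
    (residueTotal R g h).coeff a = if a = 0 then h 0 else 0 := by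
  simp [residueTotal, MvPolynomial.algebraMap_eq, MvPolynomial.coeff_C, eq_comm]

/-- Each factor is the projection onto the monomials free of `T_i`, so the product is the projection
onto constants, which factors through the span of `(T_1 ⋯ T_g)⁻¹`. -/
theorem list_prod_one_sub_polyT_polyP :
    ((List.finRange g).map fun i => 1 - polyT R i * polyP R i).prod =
      residueTotal R g ∘ₗ coresidue R g := by
  have key : ∀ (l : List (Fin g)) (p : MvPolynomial (Fin g) R) (a : Fin g →₀ ℕ),
      ((l.map fun i => 1 - polyT R i * polyP R i).prod p).coeff a =
        if ∀ i ∈ l, a i = 0 then p.coeff a else 0 := by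
    intro l p a
    induction l with
    | nil => simp
    | cons i l ih =>
      rw [List.map_cons, List.prod_cons, Module.End.mul_apply, coeff_one_sub_polyT_polyP, ih]
      simp only [List.mem_cons, forall_eq_or_imp, ite_and]
  refine LinearMap.ext fun p => MvPolynomial.ext _ _ fun a => ?_
  rw [key, LinearMap.comp_apply, coeff_residueTotal, coresidue_apply, if_pos rfl]
  have : (∀ i ∈ List.finRange g, a i = 0) ↔ a = 0 := by simp [Finsupp.ext_iff]
  simp only [this]
  split_ifs with h
  · rw [h]
  · rfl

/-- Dually, each factor keeps the inverse monomials killed by `T_i`; only multiples of `(T_1 ⋯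
T_g)⁻¹` survive all of them. -/
theorem list_prod_one_sub_invP_invMulT :
    ((List.finRange g).map fun i => 1 - invP R i * invMulT R i).prod =
      coresidue R g ∘ₗ residueTotal R g := by
  have key : ∀ (l : List (Fin g)) (h : InvPoly R g) (b : Fin g →₀ ℕ),
      ((l.map fun i => 1 - invP R i * invMulT R i).prod h) b =
        if ∀ i ∈ l, b i = 0 then h b else 0 := by
    intro l h b
    induction l with
    | nil => simp
    | cons i l ih =>
      rw [List.map_cons, List.prod_cons, Module.End.mul_apply, one_sub_invP_invMulT_apply, ih]
      simp only [List.mem_cons, forall_eq_or_imp, ite_and]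
  refine LinearMap.ext fun h => Finsupp.ext fun b => ?_
  rw [key, LinearMap.comp_apply, coresidue_apply, coeff_residueTotal, if_pos rfl]
  have : (∀ i ∈ List.finRange g, b i = 0) ↔ b = 0 := by simp [Finsupp.ext_iff]
  simp only [this]
  split_ifs with h
  · rw [h]
  · rfl

theorem polyP_comp_residueTotal (i : Fin g) : polyP R i ∘ₗ residueTotal R g = 0 := by
  refine LinearMap.ext fun h => MvPolynomial.ext _ _ fun a => ?_
  rw [LinearMap.comp_apply, coeff_polyP, coeff_residueTotal, if_neg]
  · rfl
  · intro h
    simpa using DFunLike.congr_fun h i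

theorem residueTotal_comp_invP (i : Fin g) : residueTotal R g ∘ₗ invP R i = 0 := by
  refine LinearMap.ext fun h => MvPolynomial.ext _ _ fun a => ?_
  rw [LinearMap.comp_apply, coeff_residueTotal, invP_apply]
  simp

theorem invMulT_comp_coresidue (i : Fin g) : invMulT R i ∘ₗ coresidue R g = 0 := by
  refine LinearMap.ext fun p => Finsupp.ext fun b => ?_
  rw [LinearMap.comp_apply, invMulT_apply, coresidue_apply, if_neg]
  · rfl
  · intro h
    simpa using DFunLike.congr_fun h i

theorem coresidue_comp_polyT (i : Fin g) : coresidue R g ∘ₗ polyT R i = 0 := by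
  refine LinearMap.ext fun p => Finsupp.ext fun b => ?_
  rw [LinearMap.comp_apply, coresidue_apply, coeff_polyT]
  simp

end Monomials

/-! ### The null homotopy of `δ ^ g` before restriction to a strand -/

section TotalHomotopy

variable {R : Type u} [CommRing R] {g f : ℕ} (Φ : Matrix (Fin g) (Fin f) R)

/-- Exterior multiplication by the `i`-th column of `B`. -/
def colMul (B : Matrix (Fin f) (Fin g) R) (i : Fin g) :
    Module.End R (ExteriorAlgebra R (Fin f → R)) :=
  LinearMap.mulLeft R (ExteriorAlgebra.ι R (B.col i))

theorem colMul_anticomm (B : Matrix (Fin f) (Fin g) R) (i j : Fin g) :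
    colMul B i * colMul B j = -(colMul B j * colMul B i) := by
  refine LinearMap.ext fun x => eq_neg_of_add_eq_zero_left ?_
  simp [colMul, ← mul_assoc, ← add_mul, ExteriorAlgebra.ι_add_mul_swap]

/-- Contraction is an antiderivation, so the anticommutator is the scalar `(Φ * B) i j`. -/
theorem rowContr_colMul {Φ : Matrix (Fin g) (Fin f) R} {B : Matrix (Fin f) (Fin g) R} {δ : R}
    (hB : Φ * B = Matrix.diagonal fun _ => δ) (i j : Fin g) :
    rowContr Φ i * colMul B j + colMul B j * rowContr Φ i =
      if i = j then algebraMap R _ δ else 0 := by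
  refine LinearMap.ext fun x => ?_
  have h1 : rowForm Φ i (B.col j) = if i = j then δ else 0 := by
    have := congrFun (congrFun hB i) j
    rw [Matrix.diagonal_apply] at this
    exact this
  have h2 := CliffordAlgebra.contractLeft_ι_mul (Q := (0 : QuadraticForm R (Fin f → R)))
    (d := rowForm Φ i) (B.col j) x
  change rowContr Φ i (colMul B j x) = _ - colMul B j (rowContr Φ i x) at h2
  rw [LinearMap.add_apply, Module.End.mul_apply, Module.End.mul_apply, h2, sub_add_cancel, h1]
  split_ifs <;> simp [Module.algebraMap_end_apply]

/-- The Koszul differential on `⋀ R^f ⊗ S`. -/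
def totalS : Module.End R (ExteriorAlgebra R (Fin f → R) ⊗[R] MvPolynomial (Fin g) R) :=
  koszulOp (rowContr Φ) (polyT R)

/-- The Koszul differential on `⋀ R^f ⊗ H`. -/
def totalH : Module.End R (ExteriorAlgebra R (Fin f → R) ⊗[R] InvPoly R g) :=
  koszulOp (rowContr Φ) (invMulT R)

/-- The splicing map on `⋀ R^f ⊗ H`. -/
def totalSplice : ExteriorAlgebra R (Fin f → R) ⊗[R] InvPoly R g →ₗ[R]
    ExteriorAlgebra R (Fin f → R) ⊗[R] MvPolynomial (Fin g) R :=
  TensorProduct.map (contrList Φ (List.finRange g)) (residueTotal R g)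

variable (B : Matrix (Fin f) (Fin g) R) (δ : R)

/-- The homotopy on `⋀ R^f ⊗ S`. -/
def homotopyS (l : List (Fin g)) :
    Module.End R (ExteriorAlgebra R (Fin f → R) ⊗[R] MvPolynomial (Fin g) R) :=
  listHomotopy (algebraMap R _ δ) (fun i => TensorProduct.map (colMul B i) (polyP R i))
    (defect (rowContr Φ) (colMul B) (polyT R) (polyP R)) l

/-- The homotopy on `⋀ R^f ⊗ H`. -/
def homotopyH (l : List (Fin g)) :
    Module.End R (ExteriorAlgebra R (Fin f → R) ⊗[R] InvPoly R g) :=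
  listHomotopy (algebraMap R _ δ) (fun i => TensorProduct.map (colMul B i) (invP R i))
    (defect (rowContr Φ) (colMul B) (invMulT R) (invP R)) l

/-- The component from `⋀ R^f ⊗ S` to `⋀ R^f ⊗ H` of the homotopy. -/
def homotopySplice : ExteriorAlgebra R (Fin f → R) ⊗[R] MvPolynomial (Fin g) R →ₗ[R]
    ExteriorAlgebra R (Fin f → R) ⊗[R] InvPoly R g :=
  TensorProduct.map ((List.finRange g).reverse.map (colMul B)).prod (coresidue R g)

variable {Φ B δ}

theorem rowContr_mul_self (i : Fin g) : rowContr Φ i * rowContr Φ i = 0 :=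
  LinearMap.ext fun x => rowContr_self Φ i x

theorem rowContr_anticomm (i j : Fin g) :
    rowContr Φ i * rowContr Φ j = -(rowContr Φ j * rowContr Φ i) :=
  LinearMap.ext fun x => rowContr_comm Φ i j x

theorem rowContr_colMul_ne (hB : Φ * B = Matrix.diagonal fun _ => δ) (i j : Fin g) (hij : i ≠ j) :
    rowContr Φ i * colMul B j = -(colMul B j * rowContr Φ i) := by
  have := rowContr_colMul hB i j
  rw [if_neg hij] at this
  exact eq_neg_of_add_eq_zero_left this

/-- On polynomials division undoes multiplication, so one half of the defect vanishes; on inverse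
polynomials it is the other half. -/
theorem defectS_eq (i : Fin g) : defect (rowContr Φ) (colMul B) (polyT R) (polyP R) i =
    TensorProduct.map (rowContr Φ i * colMul B i) (1 - polyT R i * polyP R i) := by
  rw [defect, polyP_mul_polyT, sub_self, TensorProduct.map_zero_right, add_zero]

theorem defectH_eq (i : Fin g) : defect (rowContr Φ) (colMul B) (invMulT R) (invP R) i =
    TensorProduct.map (colMul B i * rowContr Φ i) (1 - invP R i * invMulT R i) := by
  have h : (1 - invMulT R i * invP R i : Module.End R (InvPoly R g)) = 0 :=
    (congrArg (fun z : InvPoly R g →ₗ[R] InvPoly R g => 1 - z) (invMulT_mul_invP_self i)).trans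
      (sub_self (1 : InvPoly R g →ₗ[R] InvPoly R g))
  exact (congrArg (TensorProduct.map _ · + _) h).trans
    (by rw [TensorProduct.map_zero_right, zero_add])

/-- The polynomial side alone is contracted only up to the projection onto constants. This error
term factors through the splicing map, so the spliced complex absorbs it; `homotopyH_spec` is the
counterpart on inverse polynomials. -/
theorem homotopyS_spec (hB : Φ * B = Matrix.diagonal fun _ => δ) :
    totalS Φ * homotopyS Φ B δ (List.finRange g) + homotopyS Φ B δ (List.finRange g) * totalS Φ =
      algebraMap R _ (δ ^ g) - totalSplice Φ ∘ₗ homotopySplice B := by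
  have h := listHomotopy_spec (d := totalS Φ)
    (koszulOp_mul_self _ _ rowContr_mul_self rowContr_anticomm polyT_comm)
    (fun a => Algebra.commute_algebraMap_left δ a)
    (koszulOp_homotopy δ (rowContr Φ) (colMul B) (polyT R) (polyP R) (rowContr_colMul hB)
      polyT_mul_polyP) (List.finRange g)
  rw [homotopyS, h, List.length_finRange, map_pow, List.map_congr_left fun i _ => defectS_eq i,
    list_prod_map_map, list_prod_one_sub_polyT_polyP, totalSplice, homotopySplice,
    ← TensorProduct.map_comp, ← prod_mul_prod_reverse (rowContr Φ) (colMul B) (colMul_anticomm B)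
      (rowContr_colMul_ne hB) _ (List.nodup_finRange g)]
  rfl

theorem homotopyH_spec (hB : Φ * B = Matrix.diagonal fun _ => δ) :
    totalH Φ * homotopyH Φ B δ (List.finRange g) + homotopyH Φ B δ (List.finRange g) * totalH Φ =
      algebraMap R _ (δ ^ g) - homotopySplice B ∘ₗ totalSplice Φ := by
  have h := listHomotopy_spec (d := totalH Φ)
    (koszulOp_mul_self _ _ rowContr_mul_self rowContr_anticomm invMulT_mul_comm)
    (fun a => Algebra.commute_algebraMap_left δ a)
    (koszulOp_homotopy δ (rowContr Φ) (colMul B) (invMulT R) (invP R) (rowContr_colMul hB)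
      invMulT_mul_invP) (List.finRange g)
  rw [homotopyH, h, List.length_finRange, map_pow, List.map_congr_left fun i _ => defectH_eq i,
    list_prod_map_map, list_prod_one_sub_invP_invMulT, totalSplice, homotopySplice,
    ← TensorProduct.map_comp, ← prod_reverse_mul_prod (rowContr Φ) (colMul B) (colMul_anticomm B)
      (rowContr_colMul_ne hB) _ (List.nodup_finRange g)]
  rfl

/-- In every summand of the homotopy the operator applied first contains some `polyP i`, which kills
the constants produced by the splicing map. -/
theorem homotopyS_comp_totalSplice (l : List (Fin g)) :
    homotopyS Φ B δ l ∘ₗ totalSplice Φ = 0 := by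
  induction l with
  | nil => rfl
  | cons i l ih =>
    change (algebraMap R _ δ ^ l.length * TensorProduct.map (colMul B i) (polyP R i) +
      _ * homotopyS Φ B δ l) ∘ₗ totalSplice Φ = 0
    rw [LinearMap.add_comp, Module.End.mul_eq_comp, Module.End.mul_eq_comp, LinearMap.comp_assoc,
      LinearMap.comp_assoc, ih, totalSplice, ← TensorProduct.map_comp, polyP_comp_residueTotal,
      TensorProduct.map_zero_right, LinearMap.comp_zero, LinearMap.comp_zero, add_zero]

theorem totalSplice_comp_homotopyH (l : List (Fin g)) :
    totalSplice Φ ∘ₗ homotopyH Φ B δ l = 0 := by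
  -- The exterior factor must be arbitrary for the induction: passing a defect leaves the residue
  -- unchanged but multiplies `A` by `colMul B i * rowContr Φ i`.
  have key : ∀ (l : List (Fin g)) (A : Module.End R (ExteriorAlgebra R (Fin f → R))),
      TensorProduct.map A (residueTotal R g) ∘ₗ homotopyH Φ B δ l = 0 := by
    intro l
    induction l with
    | nil => exact fun A => LinearMap.comp_zero _
    | cons i l ih =>
      intro A
      change TensorProduct.map A (residueTotal R g) ∘ₗ
        (algebraMap R _ δ ^ l.length * TensorProduct.map (colMul B i) (invP R i) +
        defect (rowContr Φ) (colMul B) (invMulT R) (invP R) i * homotopyH Φ B δ l) = 0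
      have h1 : residueTotal R g ∘ₗ (1 - invP R i * invMulT R i) = residueTotal R g := by
        rw [LinearMap.comp_sub, Module.End.mul_eq_comp, ← LinearMap.comp_assoc,
          residueTotal_comp_invP, LinearMap.zero_comp, sub_zero]
        rfl
      rw [LinearMap.comp_add, defectH_eq, Module.End.mul_eq_comp _ (homotopyH _ _ _ _),
        ← LinearMap.comp_assoc, ← TensorProduct.map_comp, h1, ih, add_zero,
        ((Algebra.commute_algebraMap_left δ _).pow_left _).eq, Module.End.mul_eq_comp,
        ← LinearMap.comp_assoc, ← TensorProduct.map_comp, residueTotal_comp_invP,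
        TensorProduct.map_zero_right, LinearMap.zero_comp]
  exact key l _

theorem totalH_comp_homotopySplice : totalH Φ ∘ₗ homotopySplice B = 0 := by
  refine LinearMap.ext fun x => ?_
  rw [totalH, koszulOp, LinearMap.comp_apply, LinearMap.sum_apply]
  refine Finset.sum_eq_zero fun i _ => ?_
  rw [← LinearMap.comp_apply, homotopySplice, ← TensorProduct.map_comp, invMulT_comp_coresidue,
    TensorProduct.map_zero_right, LinearMap.zero_apply]

theorem homotopySplice_comp_totalS : homotopySplice B ∘ₗ totalS Φ = 0 := by
  refine LinearMap.ext fun x => ?_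
  rw [totalS, koszulOp, LinearMap.comp_apply, LinearMap.sum_apply, map_sum]
  refine Finset.sum_eq_zero fun i _ => ?_
  rw [← LinearMap.comp_apply, homotopySplice, ← TensorProduct.map_comp, coresidue_comp_polyT,
    TensorProduct.map_zero_right, LinearMap.zero_apply]

end TotalHomotopy

/-! ### Submodules of tensor products spanned by homogeneous parts -/

section MapIncl

variable {R : Type u} [CommRing R] {V N V' N' : Type*} [AddCommGroup V] [Module R V]
  [AddCommGroup N] [Module R N] [AddCommGroup V'] [Module R V'] [AddCommGroup N'] [Module R N']

theorem mapIncl_injective (p : Submodule R V) (q : Submodule R N) [Module.Flat R p]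
    [Module.Flat R N] : Function.Injective (TensorProduct.mapIncl p q) := by
  have h : TensorProduct.mapIncl p q = p.subtype.rTensor N ∘ₗ q.subtype.lTensor p := by
    rw [LinearMap.rTensor_comp_lTensor, TensorProduct.mapIncl]
  rw [h]
  exact (Module.Flat.rTensor_preserves_injective_linearMap _ p.injective_subtype).comp
    (Module.Flat.lTensor_preserves_injective_linearMap _ q.injective_subtype)

theorem map_mem_range_mapIncl {p : Submodule R V} {q : Submodule R N} {p' : Submodule R V'}
    {q' : Submodule R N'} {a : V →ₗ[R] V'} {b : N →ₗ[R] N'} (ha : ∀ x ∈ p, a x ∈ p')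
    (hb : ∀ y ∈ q, b y ∈ q') {z : V ⊗[R] N} (hz : z ∈ LinearMap.range (TensorProduct.mapIncl p q)) :
    TensorProduct.map a b z ∈ LinearMap.range (TensorProduct.mapIncl p' q') := by
  obtain ⟨z, rfl⟩ := hz
  refine ⟨TensorProduct.map (a.restrict ha) (b.restrict hb) z, ?_⟩
  have : TensorProduct.mapIncl p' q' ∘ₗ TensorProduct.map (a.restrict ha) (b.restrict hb) =
      TensorProduct.map a b ∘ₗ TensorProduct.mapIncl p q := by
    ext x y
    simp [TensorProduct.mapIncl]
  exact LinearMap.congr_fun this z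

theorem exists_lift_of_range_le {A B T : Type*} [AddCommGroup A] [Module R A] [AddCommGroup B]
    [Module R B] [AddCommGroup T] [Module R T] (i : B →ₗ[R] T) (hi : Function.Injective i)
    (φ : A →ₗ[R] T) (h : ∀ x, φ x ∈ LinearMap.range i) : ∃ ψ : A →ₗ[R] B, ∀ x, i (ψ x) = φ x := by
  refine ⟨(LinearEquiv.ofInjective i hi).symm.toLinearMap ∘ₗ φ.codRestrict _ h, fun x => ?_⟩
  have := (LinearEquiv.ofInjective i hi).apply_symm_apply (φ.codRestrict _ h x)
  exact congrArg Subtype.val this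

end MapIncl

/-! ### Restricting the homotopy to the strand of degree `ν` -/

section Homogeneous

variable {R : Type u} [CommRing R] {g f : ℕ}

theorem polyT_mem (i : Fin g) (ν k : ℕ) (p : MvPolynomial (Fin g) R)
    (hp : p ∈ polyComp R g ν (k + 1)) : polyT R i p ∈ polyComp R g ν k :=
  (mulT R i ν k ⟨p, hp⟩).2

theorem polyP_mem (i : Fin g) (ν k : ℕ) (p : MvPolynomial (Fin g) R)
    (hp : p ∈ polyComp R g ν k) : polyP R i p ∈ polyComp R g ν (k + 1) := by
  intro a ha
  have h1 : (polyP R i p).coeff a ≠ 0 := MvPolynomial.mem_support_iff.mp ha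
  rw [coeff_polyP] at h1
  have h2 := hp (MvPolynomial.mem_support_iff.mpr h1)
  simp only [Set.mem_ofPred_eq, map_add, Finsupp.degree_single] at h2 ⊢
  omega

theorem invMulT_mem (i : Fin g) (ν k : ℕ) (h : InvPoly R g)
    (hh : h ∈ invComp R g ν (k + 1)) : invMulT R i h ∈ invComp R g ν k :=
  (invCompMulT R i ν k ⟨h, hh⟩).2

theorem invP_mem (i : Fin g) (ν k : ℕ) (h : InvPoly R g)
    (hh : h ∈ invComp R g ν k) : invP R i h ∈ invComp R g ν (k + 1) := by
  intro a ha
  have h1 : invP R i h a ≠ 0 := Finsupp.mem_support_iff.mp ha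
  rw [invP_apply] at h1
  split_ifs at h1 with h0
  · exact absurd rfl h1
  · have h2 := hh (Finsupp.mem_support_iff.mpr h1)
    have h3 : a = a - Finsupp.single i 1 + Finsupp.single i 1 := by
      rw [tsub_add_cancel_of_le]
      simpa [Nat.one_le_iff_ne_zero] using h0
    rw [Set.mem_ofPred_eq] at h2 ⊢
    rw [h3, map_add, Finsupp.degree_single]
    omega

theorem coresidue_mem (ν k : ℕ) (p : MvPolynomial (Fin g) R) (hp : p ∈ polyComp R g ν k) :
    coresidue R g p ∈ invComp R g ν k := by
  intro b hb
  have h1 : coresidue R g p b ≠ 0 := Finsupp.mem_support_iff.mp hb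
  rw [coresidue_apply] at h1
  split_ifs at h1 with h0
  · subst h0
    have h2 := hp (MvPolynomial.mem_support_iff.mpr h1)
    simp only [Set.mem_ofPred_eq, map_zero] at h2 ⊢
    omega
  · exact absurd rfl h1

theorem colMul_mem (B : Matrix (Fin f) (Fin g) R) (i : Fin g) (k : ℕ)
    (x : ExteriorAlgebra R (Fin f → R)) (hx : x ∈ ⋀[R]^k (Fin f → R)) :
    colMul B i x ∈ ⋀[R]^(k + 1) (Fin f → R) := by
  change _ ∈ LinearMap.range (ExteriorAlgebra.ι R) ^ (k + 1)
  rw [pow_succ']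
  exact Submodule.mul_mem_mul ⟨_, rfl⟩ hx

theorem colMul_list_prod_mem (B : Matrix (Fin f) (Fin g) R) (l : List (Fin g)) (k : ℕ)
    (x : ExteriorAlgebra R (Fin f → R)) (hx : x ∈ ⋀[R]^k (Fin f → R)) :
    (l.map (colMul B)).prod x ∈ ⋀[R]^(l.length + k) (Fin f → R) := by
  induction l with
  | nil => simpa using hx
  | cons i l ih =>
    rw [List.map_cons, List.prod_cons, Module.End.mul_apply, List.length_cons, add_right_comm]
    exact colMul_mem B i _ _ ih

theorem rowContr_of_mem_zero (Φ : Matrix (Fin g) (Fin f) R) (i : Fin g)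
    (x : ExteriorAlgebra R (Fin f → R)) (hx : x ∈ ⋀[R]^0 (Fin f → R)) : rowContr Φ i x = 0 := by
  replace hx : x ∈ LinearMap.range (ExteriorAlgebra.ι R) ^ 0 := hx
  rw [pow_zero] at hx
  obtain ⟨r, rfl⟩ := Submodule.mem_one.mp hx
  exact CliffordAlgebra.contractLeft_algebraMap (Q := (0 : QuadraticForm R (Fin f → R)))
    (rowForm Φ i) r

theorem invMulT_of_mem_zero (i : Fin g) (ν : ℕ) (h : InvPoly R g) (hh : h ∈ invComp R g ν 0) :
    invMulT R i h = 0 := by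
  refine Finsupp.ext fun b => ?_
  by_contra h1
  have h2 := hh (Finsupp.mem_support_iff.mpr h1)
  simp only [Set.mem_ofPred_eq, map_add, Finsupp.degree_single] at h2
  omega

variable (Φ : Matrix (Fin g) (Fin f) R) (B : Matrix (Fin f) (Fin g) R) (δ : R)

/-- The image of `KS R g f ν k` in `⋀ R^f ⊗ S`. -/
def gradedS (R : Type u) [CommRing R] (g f ν k : ℕ) :
    Submodule R (ExteriorAlgebra R (Fin f → R) ⊗[R] MvPolynomial (Fin g) R) :=
  LinearMap.range (TensorProduct.mapIncl (⋀[R]^k (Fin f → R)) (polyComp R g ν k))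

/-- The image of `KH R g f ν k` in `⋀ R^f ⊗ H`. -/
def gradedH (R : Type u) [CommRing R] (g f ν k : ℕ) :
    Submodule R (ExteriorAlgebra R (Fin f → R) ⊗[R] InvPoly R g) :=
  LinearMap.range (TensorProduct.mapIncl (⋀[R]^(g + k) (Fin f → R)) (invComp R g ν k))

theorem homotopyS_mem (ν k : ℕ) (l : List (Fin g)) {z} (hz : z ∈ gradedS R g f ν k) :
    homotopyS Φ B δ l z ∈ gradedS R g f ν (k + 1) := by
  induction l with
  | nil => exact Submodule.zero_mem _
  | cons i l ih =>
    change (algebraMap R _ δ ^ l.length * TensorProduct.map (colMul B i) (polyP R i) +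
      defect (rowContr Φ) (colMul B) (polyT R) (polyP R) i * homotopyS Φ B δ l) z ∈ _
    rw [← map_pow, defectS_eq, LinearMap.add_apply, Module.End.mul_apply, Module.End.mul_apply,
      Module.algebraMap_end_apply]
    refine Submodule.add_mem _ (Submodule.smul_mem _ _ ?_) ?_
    · exact map_mem_range_mapIncl (colMul_mem B i k) (polyP_mem i ν k) hz
    · refine map_mem_range_mapIncl (fun x hx => ?_) (fun y hy => ?_) ih
      · exact contractLeft_mem (rowForm Φ i) _ _ (colMul_mem B i _ x hx)
      · exact Submodule.sub_mem _ hy (polyT_mem i ν _ _ (polyP_mem i ν _ y hy))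

theorem homotopyH_mem (ν k : ℕ) (l : List (Fin g)) {z} (hz : z ∈ gradedH R g f ν k) :
    homotopyH Φ B δ l z ∈ gradedH R g f ν (k + 1) := by
  induction l with
  | nil => exact Submodule.zero_mem _
  | cons i l ih =>
    change (algebraMap R _ δ ^ l.length * TensorProduct.map (colMul B i) (invP R i) +
      defect (rowContr Φ) (colMul B) (invMulT R) (invP R) i * homotopyH Φ B δ l) z ∈ _
    rw [← map_pow, defectH_eq, LinearMap.add_apply, Module.End.mul_apply, Module.End.mul_apply,
      Module.algebraMap_end_apply]
    refine Submodule.add_mem _ (Submodule.smul_mem _ _ ?_) ?_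
    · exact map_mem_range_mapIncl (colMul_mem B i _) (invP_mem i ν k) hz
    · refine map_mem_range_mapIncl (fun x hx => ?_) (fun y hy => ?_) ih
      · exact colMul_mem B i _ _ (contractLeft_mem (rowForm Φ i) _ x hx)
      · exact Submodule.sub_mem _ hy (invP_mem i ν _ _ (invMulT_mem i ν _ y hy))

theorem homotopySplice_mem (ν k : ℕ) {z} (hz : z ∈ gradedS R g f ν k) :
    homotopySplice B z ∈ gradedH R g f ν k := by
  refine map_mem_range_mapIncl (fun x hx => ?_) (coresidue_mem ν k) hz
  have := colMul_list_prod_mem B (List.finRange g).reverse k x hx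
  rwa [List.length_reverse, List.length_finRange] at this

/-- The differential of the total complex. -/
def totalD : Module.End R ((ExteriorAlgebra R (Fin f → R) ⊗[R] MvPolynomial (Fin g) R) ×
    (ExteriorAlgebra R (Fin f → R) ⊗[R] InvPoly R g)) :=
  ((totalS Φ).coprod (totalSplice Φ)).prod (totalH Φ ∘ₗ LinearMap.snd R _ _)

/-- The homotopy on the total complex. -/
def totalHomotopy : Module.End R ((ExteriorAlgebra R (Fin f → R) ⊗[R] MvPolynomial (Fin g) R) ×
    (ExteriorAlgebra R (Fin f → R) ⊗[R] InvPoly R g)) :=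
  (homotopyS Φ B δ (List.finRange g) ∘ₗ LinearMap.fst R _ _).prod
    ((homotopySplice B).coprod (homotopyH Φ B δ (List.finRange g)))

variable {B δ} in
-- In the mapping-cone form of the differential the diagonal entries give `δ ^ g` minus the splicing
-- composites, which the off-diagonal `homotopySplice` restores. The remaining cross terms are the
-- four vanishing composites above.
theorem totalD_totalHomotopy (hB : Φ * B = Matrix.diagonal fun _ => δ) (z) :
    totalD Φ (totalHomotopy Φ B δ z) + totalHomotopy Φ B δ (totalD Φ z) = δ ^ g • z := by
  obtain ⟨a, b⟩ := z
  have e1 := LinearMap.congr_fun (homotopyS_spec hB) a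
  have e2 := LinearMap.congr_fun (homotopyH_spec hB) b
  have e3 := LinearMap.congr_fun (homotopyS_comp_totalSplice (Φ := Φ) (B := B) (δ := δ)
    (List.finRange g)) b
  have e4 := LinearMap.congr_fun (totalSplice_comp_homotopyH (Φ := Φ) (B := B) (δ := δ)
    (List.finRange g)) b
  have e5 := LinearMap.congr_fun (totalH_comp_homotopySplice (Φ := Φ) (B := B)) a
  have e6 := LinearMap.congr_fun (homotopySplice_comp_totalS (Φ := Φ) (B := B)) a
  simp only [LinearMap.add_apply, Module.End.mul_apply, LinearMap.sub_apply,
    Module.algebraMap_end_apply, LinearMap.comp_apply, LinearMap.zero_apply] at e1 e2 e3 e4 e5 e6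
  refine Prod.ext ?_ ?_
  · change totalS Φ (homotopyS Φ B δ _ a) + totalSplice Φ (homotopySplice B a +
      homotopyH Φ B δ _ b) + homotopyS Φ B δ _ (totalS Φ a + totalSplice Φ b) = δ ^ g • a
    rw [map_add, map_add, e3, e4, add_zero, add_zero, add_right_comm, e1, sub_add_cancel]
  · change totalH Φ (homotopySplice B a + homotopyH Φ B δ _ b) +
      (homotopySplice B (totalS Φ a + totalSplice Φ b) + homotopyH Φ B δ _ (totalH Φ b)) =
        δ ^ g • b
    rw [map_add, map_add, e5, e6, zero_add, zero_add, add_left_comm, e2, add_sub_cancel]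

/-- The inclusion of `𝔅_k(Φ, ν)` into the total complex. -/
def totalIncl (R : Type u) [CommRing R] (g f ν : ℕ) : (k : ℕ) → complexX R g f ν k →ₗ[R]
    (ExteriorAlgebra R (Fin f → R) ⊗[R] MvPolynomial (Fin g) R) ×
    (ExteriorAlgebra R (Fin f → R) ⊗[R] InvPoly R g)
  | 0 => LinearMap.inl R _ _ ∘ₗ TensorProduct.mapIncl (⋀[R]^0 (Fin f → R)) (polyComp R g ν 0)
  | k + 1 => (TensorProduct.mapIncl (⋀[R]^(k + 1) (Fin f → R)) (polyComp R g ν (k + 1))).prodMap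
      (TensorProduct.mapIncl (⋀[R]^(g + k) (Fin f → R)) (invComp R g ν k))

theorem totalIncl_injective (ν k : ℕ) : Function.Injective (totalIncl R g f ν k) := by
  cases k with
  | zero => exact LinearMap.inl_injective.comp (mapIncl_injective _ _)
  | succ k => exact (mapIncl_injective _ _).prodMap (mapIncl_injective _ _)

theorem totalS_mapIncl (ν k : ℕ) (x : KS R g f ν (k + 1)) :
    totalS Φ (TensorProduct.mapIncl _ _ x) = TensorProduct.mapIncl _ _ (dS Φ ν k x) := by
  refine LinearMap.congr_fun (f := totalS Φ ∘ₗ TensorProduct.mapIncl _ _)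
    (g := TensorProduct.mapIncl _ _ ∘ₗ dS Φ ν k) (TensorProduct.ext' fun a b => ?_) x
  simp only [LinearMap.comp_apply, totalS, koszulOp, dS, LinearMap.sum_apply, map_sum,
    TensorProduct.mapIncl, TensorProduct.map_tmul]
  rfl

theorem totalH_mapIncl (ν k : ℕ) (x : KH R g f ν (k + 1)) :
    totalH Φ (TensorProduct.mapIncl _ _ x) = TensorProduct.mapIncl _ _ (dH Φ ν k x) := by
  refine LinearMap.congr_fun (f := totalH Φ ∘ₗ TensorProduct.mapIncl _ _)
    (g := TensorProduct.mapIncl _ _ ∘ₗ dH Φ ν k) (TensorProduct.ext' fun a b => ?_) x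
  simp only [LinearMap.comp_apply, totalH, koszulOp, dH, LinearMap.sum_apply, map_sum,
    TensorProduct.mapIncl, TensorProduct.map_tmul]
  rfl

theorem totalSplice_mapIncl (ν k : ℕ) (x : KH R g f ν k) :
    totalSplice Φ (TensorProduct.mapIncl _ _ x) = TensorProduct.mapIncl _ _ (splice Φ ν k x) :=
  LinearMap.congr_fun (f := totalSplice Φ ∘ₗ TensorProduct.mapIncl _ _)
    (g := TensorProduct.mapIncl _ _ ∘ₗ splice Φ ν k) (TensorProduct.ext' fun _ _ => rfl) x

theorem totalS_mapIncl_zero (ν : ℕ) (x : KS R g f ν 0) :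
    totalS Φ (TensorProduct.mapIncl _ _ x) = 0 := by
  refine LinearMap.congr_fun (f := totalS Φ ∘ₗ TensorProduct.mapIncl _ _)
    (g := 0) (TensorProduct.ext' fun a b => ?_) x
  simp only [LinearMap.comp_apply, totalS, koszulOp, LinearMap.sum_apply,
    TensorProduct.mapIncl, TensorProduct.map_tmul]
  refine Finset.sum_eq_zero fun i _ => ?_
  rw [Submodule.subtype_apply, rowContr_of_mem_zero Φ i _ a.2, TensorProduct.zero_tmul]

theorem totalH_mapIncl_zero (ν : ℕ) (x : KH R g f ν 0) :
    totalH Φ (TensorProduct.mapIncl _ _ x) = 0 := by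
  refine LinearMap.congr_fun (f := totalH Φ ∘ₗ TensorProduct.mapIncl _ _)
    (g := 0) (TensorProduct.ext' fun a b => ?_) x
  simp only [LinearMap.comp_apply, totalH, koszulOp, LinearMap.sum_apply,
    TensorProduct.mapIncl, TensorProduct.map_tmul]
  refine Finset.sum_eq_zero fun i _ => ?_
  rw [Submodule.subtype_apply, Submodule.subtype_apply, invMulT_of_mem_zero i ν _ b.2,
    TensorProduct.tmul_zero]

theorem totalD_totalIncl_zero (ν : ℕ) (x : complexX R g f ν 0) :
    totalD Φ (totalIncl R g f ν 0 x) = 0 := by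
  refine Prod.ext ?_ ?_
  · change totalS Φ (TensorProduct.mapIncl _ _ x) + totalSplice Φ 0 = 0
    exact (congrArg₂ (· + ·) (totalS_mapIncl_zero Φ ν x) (map_zero _)).trans (add_zero _)
  · change totalH Φ 0 = 0
    rw [map_zero]

theorem totalD_totalIncl_succ (ν k : ℕ) (x : complexX R g f ν (k + 1)) :
    totalD Φ (totalIncl R g f ν (k + 1) x) = totalIncl R g f ν k ((complexD Φ ν k).hom x) := by
  obtain ⟨a, b⟩ : KS R g f ν (k + 1) × KH R g f ν k := x
  have h1 : totalS Φ (TensorProduct.mapIncl _ _ a) + totalSplice Φ (TensorProduct.mapIncl _ _ b) =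
      TensorProduct.mapIncl _ _ (dS Φ ν k a + splice Φ ν k b) := by
    rw [totalS_mapIncl, totalSplice_mapIncl, map_add]
  cases k with
  | zero => exact Prod.ext h1 (totalH_mapIncl_zero Φ ν b)
  | succ k => exact Prod.ext h1 (totalH_mapIncl Φ ν k b)

theorem totalHomotopy_totalIncl_mem (ν k : ℕ) (x : complexX R g f ν k) :
    totalHomotopy Φ B δ (totalIncl R g f ν k x) ∈ LinearMap.range (totalIncl R g f ν (k + 1)) := by
  cases k with
  | zero =>
    obtain ⟨a, ha⟩ := homotopyS_mem Φ B δ ν 0 (List.finRange g) ⟨x, rfl⟩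
    obtain ⟨b, hb⟩ := homotopySplice_mem B ν 0 ⟨x, rfl⟩
    refine ⟨(a, b), Prod.ext ha (hb.trans ?_)⟩
    change _ = homotopySplice B _ + homotopyH Φ B δ _ 0
    rw [map_zero, add_zero]
    rfl
  | succ k =>
    obtain ⟨x, y⟩ : KS R g f ν (k + 1) × KH R g f ν k := x
    obtain ⟨a, ha⟩ := homotopyS_mem Φ B δ ν (k + 1) (List.finRange g) ⟨x, rfl⟩
    obtain ⟨b, hb⟩ := Submodule.add_mem _ (homotopySplice_mem B ν (k + 1) ⟨x, rfl⟩)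
      (homotopyH_mem Φ B δ ν k (List.finRange g) ⟨y, rfl⟩)
    exact ⟨(a, b), Prod.ext ha hb⟩

variable {B δ} in
-- The total homotopy raises the position by one, so it lifts through the inclusions of the strand;
-- their injectivity transports the homotopy identity.
theorem exists_homotopy (hB : Φ * B = Matrix.diagonal fun _ => δ) (ν : ℕ) :
    ∃ h : ∀ k, complexX R g f ν k →ₗ[R] complexX R g f ν (k + 1),
      (∀ x, (complexD Φ ν 0).hom (h 0 x) = δ ^ g • x) ∧
      ∀ k x, (complexD Φ ν (k + 1)).hom (h (k + 1) x) + h k ((complexD Φ ν k).hom x) =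
        δ ^ g • x := by
  choose h hh using fun k => exists_lift_of_range_le (totalIncl R g f ν (k + 1))
    (totalIncl_injective ν (k + 1)) (totalHomotopy Φ B δ ∘ₗ totalIncl R g f ν k)
    (totalHomotopy_totalIncl_mem Φ B δ ν k)
  refine ⟨h, fun x => totalIncl_injective ν 0 ?_, fun k x => totalIncl_injective ν (k + 1) ?_⟩
  · rw [← totalD_totalIncl_succ, hh, LinearMap.comp_apply, map_smul,
      ← totalD_totalHomotopy Φ hB, totalD_totalIncl_zero, map_zero, add_zero]
  · rw [map_add, ← totalD_totalIncl_succ, hh, hh, LinearMap.comp_apply, LinearMap.comp_apply,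
      map_smul, ← totalD_totalIncl_succ, totalD_totalHomotopy Φ hB]

/-- Place the adjugate of the chosen square submatrix in the rows indexed by `s`. -/
theorem exists_mul_eq_diagonal_det (s : Fin g → Fin f) :
    ∃ B : Matrix (Fin f) (Fin g) R,
      Φ * B = Matrix.diagonal fun _ => (Φ.submatrix id s).det := by
  refine ⟨(1 : Matrix (Fin f) (Fin f) R).submatrix id s * (Φ.submatrix id s).adjugate, ?_⟩
  have : Φ * (1 : Matrix (Fin f) (Fin f) R).submatrix id s = Φ.submatrix id s := by
    ext i j
    simp [Matrix.mul_apply, Matrix.one_apply]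
  rw [← Matrix.mul_assoc, this, Matrix.mul_adjugate, Matrix.smul_one_eq_diagonal]

end Homogeneous

/-! ### Powers of minors annihilate the homology -/

section Annihilation

variable {R : Type u} [CommRing R]

theorem homologyMap_smul_id {ι : Type*} {c : ComplexShape ι}
    (K : HomologicalComplex (ModuleCat.{u} R) c) (r : R) (i : ι) :
    HomologicalComplex.homologyMap (r • 𝟙 K) i = r • 𝟙 (K.homology i) := by
  have h : (HomologicalComplex.shortComplexFunctor (ModuleCat.{u} R) c i).map (r • 𝟙 K) =
      r • 𝟙 (K.sc i) := by
    ext <;> rfl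
  rw [HomologicalComplex.homologyMap, h, ShortComplex.homologyMap_smul,
    ShortComplex.homologyMap_id]
  rfl

theorem smul_homology_eq_zero_of_homotopy {ι : Type*} {c : ComplexShape ι}
    {K : HomologicalComplex (ModuleCat.{u} R) c} {r : R} (h : Homotopy (r • 𝟙 K) 0) (i : ι)
    (z : K.homology i) : r • z = 0 := by
  have h1 := h.homologyMap_eq i
  rw [homologyMap_smul_id, HomologicalComplex.homologyMap_zero] at h1
  exact congrArg (fun φ => φ.hom z) h1

variable {g f : ℕ} (Φ : Matrix (Fin g) (Fin f) R) (L : Type u) [AddCommGroup L] [Module R L]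

theorem complex_d (ν k : ℕ) : (complex Φ ν).d (k + 1) k = complexD Φ ν k :=
  ChainComplex.of_d _ _ _

theorem exists_homotopy_complex {B : Matrix (Fin f) (Fin g) R} {δ : R}
    (hB : Φ * B = Matrix.diagonal fun _ => δ) (ν : ℕ) :
    Nonempty (Homotopy (δ ^ g • 𝟙 (complex Φ ν)) 0) := by
  obtain ⟨h, h0, h1⟩ := exists_homotopy Φ hB ν
  let H : ∀ i j, (ComplexShape.down ℕ).Rel j i → ((complex Φ ν).X i ⟶ (complex Φ ν).X j) :=
    fun i j hij => Eq.rec (motive := fun j _ => (complex Φ ν).X i ⟶ (complex Φ ν).X j)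
      (ModuleCat.ofHom (h i)) hij
  have key : δ ^ g • 𝟙 (complex Φ ν) = Homotopy.nullHomotopicMap' H := by
    refine HomologicalComplex.hom_ext _ _ fun k => ?_
    cases k with
    | zero =>
      rw [Homotopy.nullHomotopicMap'_f_of_not_rel_left (k₁ := 1) (k₀ := 0) rfl (by simp)]
      refine ModuleCat.hom_ext (LinearMap.ext fun x => ?_)
      rw [complex_d]
      exact (h0 x).symm
    | succ k =>
      rw [Homotopy.nullHomotopicMap'_f (k₂ := k + 2) (k₁ := k + 1) (k₀ := k) rfl rfl]
      refine ModuleCat.hom_ext (LinearMap.ext fun x => ?_)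
      rw [complex_d, complex_d]
      exact (h1 k x).symm.trans (add_comm _ _)
  exact ⟨key ▸ Homotopy.nullHomotopy' H⟩

/-- The ideal generated by the `g`-th powers of the maximal minors. -/
def minorsPowIdeal (Φ : Matrix (Fin g) (Fin f) R) : Ideal R :=
  Ideal.span (Set.range fun s : Fin g ↪o Fin f => (Φ.submatrix id s).det ^ g)

/-- Null homotopies, unlike vanishing of homology, survive tensoring with any `L`; this is why an
explicit homotopy was needed. -/
theorem smul_homology_complexTensor {x : R} (hx : x ∈ minorsPowIdeal Φ) (ν m : ℕ)
    (z : (complexTensor Φ L ν).homology m) : x • z = 0 := by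
  induction hx using Submodule.span_induction with
  | mem x hx =>
    obtain ⟨s, rfl⟩ := hx
    obtain ⟨B, hB⟩ := exists_mul_eq_diagonal_det Φ s
    obtain ⟨h⟩ := exists_homotopy_complex Φ hB ν
    have h2 := (MonoidalCategory.tensorRight (ModuleCat.of R L)).mapHomotopy h
    have e1 : ((MonoidalCategory.tensorRight (ModuleCat.of R L)).mapHomologicalComplex
        (ComplexShape.down ℕ)).map ((Φ.submatrix id s).det ^ g • 𝟙 (complex Φ ν)) =
        (Φ.submatrix id s).det ^ g • 𝟙 (complexTensor Φ L ν) := by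
      ext k : 1
      change (MonoidalCategory.tensorRight (ModuleCat.of R L)).map
        ((Φ.submatrix id s).det ^ g • 𝟙 ((complex Φ ν).X k)) = _
      rw [CategoryTheory.Functor.map_smul, CategoryTheory.Functor.map_id]
      rfl
    rw [e1, Functor.map_zero] at h2
    exact smul_homology_eq_zero_of_homotopy h2 m z
  | zero => exact zero_smul _ _
  | add x y _ _ hx hy => rw [add_smul, hx, hy, add_zero]
  | smul r x _ hx => rw [smul_eq_mul, mul_smul, hx, smul_zero]

end Annihilation

/-! ### Exactness in the coefficient module, from flatness of the terms -/

section LongExact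

variable {R : Type u} [CommRing R] {g f : ℕ} (Φ : Matrix (Fin g) (Fin f) R)

instance complexX_flat (ν k : ℕ) : Module.Flat R ((complex Φ ν).X k) := by
  have hp : ∀ k, Module.Free R (polyComp R g ν k) := fun k =>
    Module.Free.of_basis (MvPolynomial.basisRestrictSupport R _)
  have hi : ∀ k, Module.Free R (invComp R g ν k) := fun k =>
    Module.Free.of_equiv (Finsupp.supportedEquivFinsupp _).symm
  cases k with
  | zero => exact (inferInstance : Module.Flat R (KS R g f ν 0))
  | succ k => exact (inferInstance : Module.Flat R (KS R g f ν (k + 1) × KH R g f ν k))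

/-- The short complex of complexes `𝔅(Φ, ν) ⊗ S` for a short complex `S` of modules. -/
def complexTensorShortComplex (ν : ℕ) (S : ShortComplex (ModuleCat.{u} R)) :
    ShortComplex (ChainComplex (ModuleCat.{u} R) ℕ) where
  X₁ := complexTensor Φ S.X₁ ν
  X₂ := complexTensor Φ S.X₂ ν
  X₃ := complexTensor Φ S.X₃ ν
  f := (NatTrans.mapHomologicalComplex
    ((MonoidalCategory.tensoringRight (ModuleCat.{u} R)).map S.f) _).app (complex Φ ν)
  g := (NatTrans.mapHomologicalComplex
    ((MonoidalCategory.tensoringRight (ModuleCat.{u} R)).map S.g) _).app (complex Φ ν)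
  zero := by
    ext k : 1
    change MonoidalCategory.whiskerLeft _ S.f ≫ MonoidalCategory.whiskerLeft _ S.g = 0
    rw [← MonoidalCategory.whiskerLeft_comp, S.zero, MonoidalPreadditive.whiskerLeft_zero]

theorem complexTensorShortComplex_shortExact (ν : ℕ) {S : ShortComplex (ModuleCat.{u} R)}
    (hS : S.ShortExact) : (complexTensorShortComplex Φ ν S).ShortExact := by
  refine HomologicalComplex.shortExact_of_degreewise_shortExact _ fun k => ?_
  exact hS.map_of_exact (MonoidalCategory.tensorLeft ((complex Φ ν).X k))

end LongExact

/-! ### Formal properties common to `Ext` and the homology of the complex -/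

section ShiftSequence

variable {R : Type u} [CommRing R]

theorem IsSMulRegular.linearMap {N L : Type*} [AddCommGroup N] [Module R N] [AddCommGroup L]
    [Module R L] {x : R} (hx : IsSMulRegular L x) : IsSMulRegular (N →ₗ[R] L) x :=
  fun _ _ h => LinearMap.ext fun n => hx (LinearMap.congr_fun h n)

theorem subsingleton_of_isSMulRegular {L : Type*} [AddCommGroup L] [Module R L] {x : R}
    (hx : IsSMulRegular L x) (h : ∀ z : L, x • z = 0) : Subsingleton L :=
  ⟨fun a b => hx ((h a).trans (h b).symm)⟩

/-- A sequence of functions on modules behaving like `Ext_R^n(N, -)` with respect to the quotients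
by regular elements of an ideal `J` annihilating it. -/
structure IsShiftSequence (F : ℕ → ModuleCat.{u} R → ModuleCat.{u} R) (J : Ideal R)
    (N : Type u) [AddCommGroup N] [Module R N] : Prop where
  smul_eq_zero : ∀ n L, ∀ x ∈ J, ∀ z : F n L, x • z = 0
  regular_succ : ∀ n (L : ModuleCat.{u} R) (x : R), IsSMulRegular L x →
    Subsingleton (F n (ModuleCat.of R (QuotSMulTop x L))) → IsSMulRegular (F (n + 1) L) x
  shift : ∀ n (L : ModuleCat.{u} R), ∀ x ∈ J, IsSMulRegular L x → Subsingleton (F n L) →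
    Nonempty (F n (ModuleCat.of R (QuotSMulTop x L)) ≃ₗ[R] F (n + 1) L)
  zero : ∀ L : ModuleCat.{u} R, Nonempty (F 0 L ≃ₗ[R] (N →ₗ[R] L))

namespace IsShiftSequence

variable {F : ℕ → ModuleCat.{u} R → ModuleCat.{u} R} {J : Ideal R} {N : Type u} [AddCommGroup N]
  [Module R N]

/-- By induction, applied to `L/rL`, the element `r` is regular on `F i L`; yet a power of `r`
annihilates `F i L`. Only that power has to lie in `J`, so the radical suffices here, whereas the
isomorphisms below need elements of `J` itself. -/
theorem subsingleton_of_isWeaklyRegular (hF : IsShiftSequence F J N) (rs : List R)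
    (hrs : ∀ r ∈ rs, r ∈ J.radical) (L : ModuleCat.{u} R)
    (hL : RingTheory.Sequence.IsWeaklyRegular L rs) (i : ℕ) (hi : i < rs.length) :
    Subsingleton (F i L) := by
  induction rs generalizing L i with
  | nil => simp at hi
  | cons r rs ih =>
    obtain ⟨h1, h2⟩ := (RingTheory.Sequence.isWeaklyRegular_cons_iff L r rs).mp hL
    obtain ⟨m, hm⟩ := hrs r List.mem_cons_self
    have hreg : IsSMulRegular (F i L) r := by
      cases i with
      | zero =>
        obtain ⟨e⟩ := hF.zero L
        exact (e.isSMulRegular_congr r).mpr (IsSMulRegular.linearMap h1)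
      | succ i =>
        exact hF.regular_succ i L r h1 (ih (fun s hs => hrs s (List.mem_cons_of_mem _ hs))
          (ModuleCat.of R (QuotSMulTop r L)) h2 i (by simpa using hi))
    exact subsingleton_of_isSMulRegular (hreg.pow m) (hF.smul_eq_zero i L _ hm)

/-- Dividing by one element of the sequence lowers the index by one, down to `F 0 = Hom(N, -)`; the
vanishing lemma supplies the hypothesis of each shift. -/
theorem nonempty_equiv_of_isWeaklyRegular (hF : IsShiftSequence F J N) (rs : List R)
    (hrs : ∀ r ∈ rs, r ∈ J) (L : ModuleCat.{u} R)
    (hL : RingTheory.Sequence.IsWeaklyRegular L rs) :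
    Nonempty (F rs.length L ≃ₗ[R] (N →ₗ[R] L ⧸ (Ideal.ofList rs • ⊤ : Submodule R L))) := by
  induction rs generalizing L with
  | nil =>
    obtain ⟨e⟩ := hF.zero L
    have h : (Ideal.ofList ([] : List R) • ⊤ : Submodule R L) = ⊥ := by
      rw [Ideal.ofList_nil, Submodule.bot_smul]
    exact ⟨e.trans (LinearEquiv.congrRight (Submodule.quotEquivOfEqBot _ h).symm)⟩
  | cons r rs ih =>
    have hrad : ∀ s ∈ r :: rs, s ∈ J.radical := fun s hs => Ideal.le_radical (hrs s hs)
    have h0 := hF.subsingleton_of_isWeaklyRegular _ hrad L hL rs.length (by simp)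
    obtain ⟨h1, h2⟩ := (RingTheory.Sequence.isWeaklyRegular_cons_iff L r rs).mp hL
    obtain ⟨e1⟩ := hF.shift rs.length L r (hrs r List.mem_cons_self) h1 h0
    obtain ⟨e2⟩ := ih (fun s hs => hrs s (List.mem_cons_of_mem _ hs))
      (ModuleCat.of R (QuotSMulTop r L)) h2
    exact ⟨e1.symm.trans (e2.trans (LinearEquiv.congrRight
      (Submodule.quotOfListConsSMulTopEquivQuotSMulTopInner L r rs).symm))⟩

end IsShiftSequence

open Abelian in
-- Everything comes from the long exact sequence of `0 → L → L → L/xL → 0`. For `x` in `J` the map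
-- induced by `x` on `Ext` is zero, since it can be computed on the first argument.
theorem isShiftSequence_ext (J : Ideal R) (N : Type u) [AddCommGroup N] [Module R N]
    (hJ : ∀ x ∈ J, ∀ n : N, x • n = 0) :
    IsShiftSequence (fun n L => ModuleCat.of R (Ext (ModuleCat.of R N) L n)) J N := by
  have hcomp : ∀ {L : ModuleCat.{u} R} (x : R) {n : ℕ} (z : Ext (ModuleCat.of R N) L n),
      z.comp (Ext.mk₀ (x • 𝟙 L)) (add_zero n) = x • z := by
    intro L x n z
    rw [Ext.mk₀_smul, Ext.comp_smul, Ext.comp_mk₀_id]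
  have hsmul : ∀ (L : ModuleCat.{u} R) (n : ℕ), ∀ x ∈ J, ∀ z : Ext (ModuleCat.of R N) L n,
      x • z = 0 := by
    intro L n x hx z
    have h : x • 𝟙 (ModuleCat.of R N) = 0 :=
      ModuleCat.hom_ext (LinearMap.ext fun n => hJ x hx n)
    rw [← Ext.mk₀_id_comp z, ← Ext.smul_comp, ← Ext.mk₀_smul, h, Ext.mk₀_zero, Ext.zero_comp]
  refine ⟨fun n L x hx z => hsmul L n x hx z, fun n L x hx hn => ?_, fun n L x hxJ hx hn => ?_,
    fun L => ⟨Ext.linearEquiv₀.trans ModuleCat.homLinearEquiv⟩⟩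
  · refine IsSMulRegular.of_right_eq_zero_of_smul fun z hz => ?_
    obtain ⟨y, hy⟩ := Ext.covariant_sequence_exact₁ (ModuleCat.of R N)
      hx.smulShortComplex_shortExact (n₀ := n) z ((hcomp x z).trans hz) rfl
    rw [← hy, show y = 0 from @Subsingleton.elim _ hn y 0, Ext.zero_comp]
    rfl
  · refine ⟨LinearEquiv.ofBijective (hx.smulShortComplex_shortExact.extClass.postcompOfLinear R
      (ModuleCat.of R N) rfl) ⟨?_, fun z => ?_⟩⟩
    · refine (injective_iff_map_eq_zero _).mpr fun y hy => ?_
      obtain ⟨w, hw⟩ := Ext.covariant_sequence_exact₃ (ModuleCat.of R N)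
        hx.smulShortComplex_shortExact y rfl hy
      rw [← hw, show w = 0 from @Subsingleton.elim _ hn w 0, Ext.zero_comp]
    · exact Ext.covariant_sequence_exact₁ (ModuleCat.of R N)
        hx.smulShortComplex_shortExact (n₀ := n) z ((hcomp x z).trans (hsmul _ _ x hxJ z)) rfl

end ShiftSequence

/-! ### The homology of the complex as a shift sequence -/

section HomologyShift

variable {R : Type u} [CommRing R] {g f : ℕ} (Φ : Matrix (Fin g) (Fin f) R)

/-- The homology of `𝔅(Φ, L, ν)`, indexed from `N` downwards. -/
def topHomology (ν N n : ℕ) (L : ModuleCat.{u} R) : ModuleCat.{u} R :=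
  if n ≤ N then (complexTensor Φ L ν).homology (N - n) else ModuleCat.of R PUnit

theorem topHomology_of_le (ν : ℕ) {N n : ℕ} (h : n ≤ N) (L : ModuleCat.{u} R) :
    topHomology Φ ν N n L = (complexTensor Φ L ν).homology (N - n) := if_pos h

theorem topHomology_of_not_le (ν : ℕ) {N n : ℕ} (h : ¬ n ≤ N) (L : ModuleCat.{u} R) :
    topHomology Φ ν N n L = ModuleCat.of R PUnit := if_neg h

variable {L : ModuleCat.{u} R} {x : R}

theorem homologyMap_complexTensorShortComplex_f (ν m : ℕ) :
    HomologicalComplex.homologyMap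
      (complexTensorShortComplex Φ ν (L.smulShortComplex x)).f m =
      x • 𝟙 ((complexTensor Φ L ν).homology m) := by
  have h : (complexTensorShortComplex Φ ν (L.smulShortComplex x)).f =
      x • 𝟙 (complexTensor Φ L ν) := by
    ext k : 1
    change MonoidalCategory.whiskerLeft ((complex Φ ν).X k) (x • 𝟙 L) = _
    rw [MonoidalLinear.whiskerLeft_smul, MonoidalCategory.whiskerLeft_id]
    rfl
  rw [h]
  exact homologyMap_smul_id _ x m

theorem isSMulRegular_homology (hx : IsSMulRegular L x) (ν m : ℕ)
    (h : Subsingleton ((complexTensor Φ (QuotSMulTop x L) ν).homology (m + 1))) :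
    IsSMulRegular ((complexTensor Φ L ν).homology m) x := by
  have hS := complexTensorShortComplex_shortExact Φ ν hx.smulShortComplex_shortExact
  have h0 : Limits.IsZero ((complexTensor Φ (QuotSMulTop x L) ν).homology (m + 1)) :=
    ModuleCat.isZero_of_iff_subsingleton.mpr h
  have h1 := (hS.homology_exact₁ (m + 1) m rfl).mono_g (h0.eq_of_src _ _)
  have h2 := (ModuleCat.mono_iff_injective _).mp h1
  have h3 : ∀ z : (complexTensor Φ L ν).homology m, (HomologicalComplex.homologyMap
      (complexTensorShortComplex Φ ν (L.smulShortComplex x)).f m).hom z = x • z := fun z =>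
    LinearMap.congr_fun (congrArg ModuleCat.Hom.hom
      (homologyMap_complexTensorShortComplex_f Φ (L := L) (x := x) ν m)) z
  exact fun a b hab => h2 ((h3 a).trans (hab.trans (h3 b).symm))

theorem nonempty_homology_equiv (hx : IsSMulRegular L x) (ν m : ℕ)
    (hz : ∀ z : (complexTensor Φ L ν).homology m, x • z = 0)
    (h : Subsingleton ((complexTensor Φ L ν).homology (m + 1))) :
    Nonempty ((complexTensor Φ (QuotSMulTop x L) ν).homology (m + 1) ≃ₗ[R]
      (complexTensor Φ L ν).homology m) := by
  have hS := complexTensorShortComplex_shortExact Φ ν hx.smulShortComplex_shortExact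
  have h1 := hS.mono_δ (m + 1) m rfl (ModuleCat.isZero_of_iff_subsingleton.mpr h)
  have h2 : Epi (hS.δ (m + 1) m rfl) := by
    refine (hS.homology_exact₁ (m + 1) m rfl).epi_f ?_
    exact (homologyMap_complexTensorShortComplex_f Φ ν m).trans
      (ModuleCat.hom_ext (LinearMap.ext hz))
  have h3 := isIso_of_mono_of_epi (hS.δ (m + 1) m rfl)
  exact ⟨(asIso (hS.δ (m + 1) m rfl)).toLinearEquiv⟩

theorem subsingleton_homology_zero (hx : IsSMulRegular L x) (ν : ℕ)
    (h : Subsingleton ((complexTensor Φ L ν).homology 0)) :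
    Subsingleton ((complexTensor Φ (QuotSMulTop x L) ν).homology 0) := by
  have hS := complexTensorShortComplex_shortExact Φ ν hx.smulShortComplex_shortExact
  have := hS.epi_g
  have h1 := HomologicalComplex.epi_homologyMap_of_epi_of_not_rel
    (complexTensorShortComplex Φ ν (L.smulShortComplex x)).g 0 (by simp)
  exact @Function.Surjective.subsingleton _ _ _ h ((ModuleCat.epi_iff_surjective _).mp h1)

theorem isShiftSequence_topHomology (ν N : ℕ) (P : Type u) [AddCommGroup P] [Module R P]
    (hP : ∀ L : ModuleCat.{u} R, Nonempty ((complexTensor Φ L ν).homology N ≃ₗ[R] (P →ₗ[R] L))) :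
    IsShiftSequence (topHomology Φ ν N) (minorsPowIdeal Φ) P := by
  have hsub : ∀ n, ¬ n ≤ N → ∀ L, Subsingleton (topHomology Φ ν N n L) := fun n hn L => by
    rw [topHomology_of_not_le Φ ν hn]
    exact inferInstanceAs (Subsingleton PUnit)
  refine ⟨fun n L x hx z => ?_, fun n L x hx h => ?_, fun n L x hxJ hx h => ?_, fun L => ?_⟩
  · by_cases hn : n ≤ N
    · revert z
      rw [topHomology_of_le Φ ν hn]
      exact smul_homology_complexTensor Φ L hx ν _
    · have := hsub n hn L
      exact Subsingleton.elim _ _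
  · by_cases hn : n + 1 ≤ N
    · rw [topHomology_of_le Φ ν (by omega), show N - n = N - (n + 1) + 1 by omega] at h
      rw [topHomology_of_le Φ ν hn]
      exact isSMulRegular_homology Φ hx ν _ h
    · have := hsub _ hn L
      exact fun _ _ _ => Subsingleton.elim _ _
  · by_cases hn : n + 1 ≤ N
    · rw [topHomology_of_le Φ ν (by omega), show N - n = N - (n + 1) + 1 by omega] at h ⊢
      rw [topHomology_of_le Φ ν hn]
      exact nonempty_homology_equiv Φ hx ν _ (smul_homology_complexTensor Φ L hxJ ν _) h
    -- Beyond the bottom of the complex the target is zero, so the source must vanish too. At `n =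
    -- N` this is right exactness of homology in degree zero.
    · have h1 := hsub _ hn L
      have h2 : Subsingleton (topHomology Φ ν N n (ModuleCat.of R (QuotSMulTop x L))) := by
        by_cases hn' : n ≤ N
        · rw [topHomology_of_le Φ ν hn', show N - n = 0 by omega] at h ⊢
          exact subsingleton_homology_zero Φ hx ν h
        · exact hsub _ hn' _
      exact ⟨0⟩
  · rw [topHomology_of_le Φ ν (Nat.zero_le N)]
    exact hP L

end HomologyShift

/-! ### Linear maps out of symmetric powers of the cokernel -/

section SymmetricPower

variable {R : Type u} [CommRing R] {g f : ℕ} (Φ : Matrix (Fin g) (Fin f) R)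

/-- The exponents indexing the basis of `invComp R g ν k`. -/
abbrev Exponents (g ν k : ℕ) : Type := {b : Fin g →₀ ℕ // b.degree + ν = k}

/-- The exponent `b + e_i`. -/
def Exponents.up {ν k : ℕ} (i : Fin g) (b : Exponents g ν k) : Exponents g ν (k + 1) :=
  ⟨b.1 + Finsupp.single i 1, by
    have := b.2
    simp only [map_add, Finsupp.degree_single]
    omega⟩

instance (ν k : ℕ) : Finite (Exponents g ν k) :=
  ((Finsupp.finite_of_degree_le (σ := Fin g) k).subset fun b (hb : b.degree + ν = k) => by
    change b.degree ≤ k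
    omega).to_subtype

/-- The map taking `h` to `(j, b) ↦ ∑ i, Φ i j • h (b + e_i)`. -/
def shiftMap (L : Type u) [AddCommGroup L] [Module R L] (ν k : ℕ) :
    (Exponents g ν (k + 1) → L) →ₗ[R] (Fin f → Exponents g ν k → L) where
  toFun h j b := ∑ i, Φ i j • h (b.up i)
  map_add' h h' := by
    ext j b
    simp [Finset.sum_add_distrib]
  map_smul' r h := by
    ext j b
    simp only [Pi.smul_apply, RingHom.id_apply, Finset.smul_sum, smul_comm r]

/-- The algebra map from `R[T_1, …, T_g]` to the symmetric algebra of the cokernel. -/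
def polyToSym : MvPolynomial (Fin g) R →ₐ[R] SymmetricAlgebra R (Coker Φ) :=
  MvPolynomial.aeval fun i =>
    SymmetricAlgebra.ι R (Coker Φ) (Submodule.Quotient.mk (Pi.single i 1))

theorem ι_mk (v : Fin g → R) :
    SymmetricAlgebra.ι R (Coker Φ) (Submodule.Quotient.mk v) =
      polyToSym Φ (∑ i, v i • MvPolynomial.X i) := by
  conv_lhs => rw [pi_eq_sum_univ' v]
  simp only [polyToSym, map_sum, map_smul, MvPolynomial.aeval_X]
  rw [← Submodule.mkQ_apply, map_sum, map_sum]
  refine Finset.sum_congr rfl fun i _ => ?_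
  rw [map_smul, map_smul, Submodule.mkQ_apply]

/-- The linear form `∑ i, Φ i j T_i`. -/
def colPoly (j : Fin f) : MvPolynomial (Fin g) R := ∑ i, Φ i j • MvPolynomial.X i

theorem polyToSym_colPoly (j : Fin f) : polyToSym Φ (colPoly Φ j) = 0 := by
  rw [colPoly, ← ι_mk Φ (fun i => Φ i j), (Submodule.Quotient.mk_eq_zero _).mpr, map_zero]
  refine ⟨Pi.single j 1, ?_⟩
  rw [Matrix.mulVecLin_apply, Matrix.mulVec_single_one]
  rfl

theorem symPow_eq_map (t : ℕ) : SymPow R t (Coker Φ) =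
    (MvPolynomial.homogeneousSubmodule (Fin g) R t).map (polyToSym Φ).toLinearMap := by
  have h : LinearMap.range (SymmetricAlgebra.ι R (Coker Φ)) =
      (MvPolynomial.homogeneousSubmodule (Fin g) R 1).map (polyToSym Φ).toLinearMap := by
    rw [MvPolynomial.homogeneousSubmodule_one_eq_span_X, Submodule.map_span]
    refine le_antisymm ?_ (Submodule.span_le.mpr ?_)
    · rintro _ ⟨m, rfl⟩
      obtain ⟨v, rfl⟩ := Submodule.Quotient.mk_surjective _ m
      rw [ι_mk, map_sum]
      refine Submodule.sum_mem _ fun i _ => ?_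
      rw [map_smul]
      exact Submodule.smul_mem _ _ (Submodule.subset_span ⟨_, ⟨i, rfl⟩, rfl⟩)
    · rintro _ ⟨_, ⟨i, rfl⟩, rfl⟩
      exact ⟨Submodule.Quotient.mk (Pi.single i 1), (MvPolynomial.aeval_X (fun i =>
        SymmetricAlgebra.ι R (Coker Φ) (Submodule.Quotient.mk (Pi.single i 1))) i).symm⟩
  rw [SymPow, h, ← Submodule.map_pow, MvPolynomial.homogeneousSubmodule_one_pow]

theorem polyToSym_monomial_mem {ν k : ℕ} (b : Exponents g ν k) :
    polyToSym Φ (MvPolynomial.monomial b.1 1) ∈ SymPow R (k - ν) (Coker Φ) := by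
  rw [symPow_eq_map]
  refine ⟨_, MvPolynomial.isHomogeneous_monomial _ ?_, rfl⟩
  have := b.2
  omega

/-- The monomials as elements of the symmetric power of the cokernel. -/
def symMonomial {ν k : ℕ} (b : Exponents g ν k) : SymPow R (k - ν) (Coker Φ) :=
  ⟨_, polyToSym_monomial_mem Φ b⟩

/-- The monomials of degree `k - ν` span the symmetric power. Without `ν ≤ k` truncated subtraction
would give the zeroth power while there are no exponents at all. -/
theorem symPow_hom_ext {L : Type*} [AddCommGroup L] [Module R L] {ν k : ℕ} (hk : ν ≤ k)
    {φ ψ : SymPow R (k - ν) (Coker Φ) →ₗ[R] L}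
    (h : ∀ b : Exponents g ν k, φ (symMonomial Φ b) = ψ (symMonomial Φ b)) : φ = ψ := by
  have hmem : ∀ p ∈ MvPolynomial.homogeneousSubmodule (Fin g) R (k - ν),
      polyToSym Φ p ∈ SymPow R (k - ν) (Coker Φ) := fun p hp => by
    rw [symPow_eq_map]
    exact ⟨p, hp, rfl⟩
  refine LinearMap.ext fun ⟨z, hz⟩ => ?_
  obtain ⟨p, hp, rfl⟩ := (symPow_eq_map Φ _ ▸ hz : z ∈ _)
  change φ ⟨polyToSym Φ p, hmem p hp⟩ = ψ ⟨polyToSym Φ p, hmem p hp⟩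
  have hsum : (⟨polyToSym Φ p, hmem p hp⟩ : SymPow R (k - ν) (Coker Φ)) =
      ∑ b ∈ p.support.attach, p.coeff b.1 • symMonomial Φ (⟨b.1, by
        have := hp (MvPolynomial.mem_support_iff.mp b.2)
        change Finsupp.weight (fun _ => 1) b.1 = k - ν at this
        rw [← Finsupp.degree_eq_weight_one] at this
        omega⟩ : Exponents g ν k) := by
    refine Subtype.ext ?_
    rw [AddSubmonoidClass.coe_finsetSum]
    change polyToSym Φ p = ∑ b ∈ p.support.attach,
      p.coeff b.1 • polyToSym Φ (MvPolynomial.monomial b.1 1)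
    rw [Finset.sum_attach p.support fun b => p.coeff b • polyToSym Φ (MvPolynomial.monomial b 1)]
    conv_lhs => rw [p.as_sum, map_sum]
    refine Finset.sum_congr rfl fun b _ => ?_
    rw [← map_smul, MvPolynomial.smul_monomial, smul_eq_mul, mul_one]
  rw [hsum, map_sum, map_sum]
  exact Finset.sum_congr rfl fun b _ => by rw [map_smul, map_smul, h]

variable (L : Type u) [AddCommGroup L] [Module R L]

/-- Extend `h` by zero to a functional on all polynomials. The kernel condition says that it kills
every monomial multiple of the forms `γ_j`, hence the ideal they generate; the symmetric algebra
maps to the quotient by that ideal. -/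
theorem exists_hom_of_mem_ker_shiftMap {ν k : ℕ} {h : Exponents g ν (k + 1) → L}
    (hh : shiftMap Φ L ν k h = 0) :
    ∃ φ : SymPow R (k + 1 - ν) (Coker Φ) →ₗ[R] L, ∀ b, φ (symMonomial Φ b) = h b := by
  classical
  let I : Ideal (MvPolynomial (Fin g) R) := Ideal.span (Set.range (colPoly Φ))
  let c : (Fin g →₀ ℕ) → L := fun b => if hb : b.degree + ν = k + 1 then h ⟨b, hb⟩ else 0
  let H : MvPolynomial (Fin g) R →ₗ[R] L := (MvPolynomial.basisMonomials (Fin g) R).constr R c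
  have hH : ∀ b, H (MvPolynomial.monomial b 1) = c b := fun b => by
    have := (MvPolynomial.basisMonomials (Fin g) R).constr_basis R c b
    rwa [MvPolynomial.coe_basisMonomials] at this
  have hcol : ∀ j b, H (MvPolynomial.monomial b 1 * colPoly Φ j) = 0 := by
    intro j b
    have h1 : H (MvPolynomial.monomial b 1 * colPoly Φ j) =
        ∑ i, Φ i j • c (b + Finsupp.single i 1) := by
      rw [colPoly, Finset.mul_sum, map_sum]
      refine Finset.sum_congr rfl fun i _ => ?_
      rw [mul_smul_comm, map_smul, MvPolynomial.X, MvPolynomial.monomial_mul, mul_one, hH]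
    rw [h1]
    by_cases hb : b.degree + ν = k
    · refine Eq.trans (Finset.sum_congr rfl fun i _ => ?_) (congrFun (congrFun hh j) ⟨b, hb⟩)
      have h2 : (b + Finsupp.single i 1).degree + ν = k + 1 := (Exponents.up i ⟨b, hb⟩).2
      simp only [c, dif_pos h2]
      rfl
    · refine Finset.sum_eq_zero fun i _ => ?_
      have h2 : ¬ (b + Finsupp.single i 1).degree + ν = k + 1 := by
        rw [map_add, Finsupp.degree_single]
        omega
      simp only [c, dif_neg h2, smul_zero]
  have hI : I.restrictScalars R ≤ LinearMap.ker H := by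
    intro p hp
    obtain ⟨a, rfl⟩ := Ideal.mem_span_range_iff_exists_fun.mp hp
    rw [LinearMap.mem_ker, map_sum]
    refine Finset.sum_eq_zero fun j _ => ?_
    have h2 : H ∘ₗ LinearMap.mulRight R (colPoly Φ j) = 0 :=
      (MvPolynomial.basisMonomials (Fin g) R).ext fun b => by
        rw [MvPolynomial.coe_basisMonomials]
        exact hcol j b
    exact LinearMap.congr_fun h2 (a j)
  let lin : Coker Φ →ₗ[R] MvPolynomial (Fin g) R ⧸ I := Submodule.liftQ _
    (Fintype.linearCombination R fun i => Ideal.Quotient.mk I (MvPolynomial.X i)) (by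
      rintro _ ⟨w, rfl⟩
      rw [LinearMap.mem_ker, Fintype.linearCombination_apply]
      have h3 : ∑ i, Φ.mulVecLin w i • Ideal.Quotient.mk I (MvPolynomial.X i) =
          ∑ j, w j • Ideal.Quotient.mk I (colPoly Φ j) := by
        simp only [Matrix.mulVecLin_apply, Matrix.mulVec, dotProduct, colPoly, map_sum,
          Finset.smul_sum, Finset.sum_smul]
        rw [Finset.sum_comm]
        refine Finset.sum_congr rfl fun j _ => Finset.sum_congr rfl fun i _ => ?_
        rw [mul_comm, mul_smul]
        rfl
      rw [h3]
      refine Finset.sum_eq_zero fun j _ => ?_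
      have h5 : colPoly Φ j ∈ I := Ideal.subset_span (Set.mem_range_self j)
      rw [Ideal.Quotient.eq_zero_iff_mem.mpr h5, smul_zero])
  have hlin : ∀ p, SymmetricAlgebra.lift lin (polyToSym Φ p) = Ideal.Quotient.mkₐ R I p := by
    intro p
    refine AlgHom.congr_fun (φ₁ := (SymmetricAlgebra.lift lin).comp (polyToSym Φ))
      (φ₂ := Ideal.Quotient.mkₐ R I) (MvPolynomial.algHom_ext fun i => ?_) p
    rw [AlgHom.comp_apply, polyToSym, MvPolynomial.aeval_X, SymmetricAlgebra.lift_ι_apply,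
      Submodule.liftQ_apply, Fintype.linearCombination_apply_single, one_smul]
    rfl
  refine ⟨(I.restrictScalars R).liftQ H hI ∘ₗ
    (Submodule.Quotient.restrictScalarsEquiv R I).symm.toLinearMap ∘ₗ
    (SymmetricAlgebra.lift lin).toLinearMap ∘ₗ Submodule.subtype _, fun b => ?_⟩
  have h4 := hlin (MvPolynomial.monomial b.1 1)
  simp only [LinearMap.comp_apply, AlgHom.toLinearMap_apply, Submodule.subtype_apply, symMonomial]
  rw [h4]
  change H (MvPolynomial.monomial b.1 1) = h b
  rw [hH]
  exact dif_pos b.2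

/-- The values at the monomials of a linear map on the symmetric power. -/
def evalMonomials (ν k : ℕ) :
    (SymPow R (k + 1 - ν) (Coker Φ) →ₗ[R] L) →ₗ[R] LinearMap.ker (shiftMap Φ L ν k) where
  toFun φ := ⟨fun b => φ (symMonomial Φ b), by
    refine LinearMap.mem_ker.mpr (funext fun j => funext fun b => ?_)
    change ∑ i, Φ i j • φ (symMonomial Φ (b.up i)) = 0
    simp only [← map_smul, ← map_sum]
    convert map_zero φ
    refine Subtype.ext ?_
    rw [AddSubmonoidClass.coe_finsetSum]
    change ∑ i, Φ i j • polyToSym Φ (MvPolynomial.monomial (b.1 + Finsupp.single i 1) 1) = 0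
    have h1 : ∑ i, Φ i j • polyToSym Φ (MvPolynomial.monomial (b.1 + Finsupp.single i 1) 1) =
        polyToSym Φ (MvPolynomial.monomial b.1 1 * colPoly Φ j) := by
      rw [colPoly, Finset.mul_sum, map_sum]
      refine Finset.sum_congr rfl fun i _ => ?_
      rw [mul_smul_comm, map_smul, MvPolynomial.X, MvPolynomial.monomial_mul, mul_one]
    rw [h1, map_mul, polyToSym_colPoly, mul_zero]⟩
  map_add' _ _ := rfl
  map_smul' _ _ := rfl

/-- This is left exactness of `Hom(-, L)` on the presentation of the symmetric power by monomials
modulo the forms `γ_j`, so no condition on `L` is needed. -/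
theorem evalMonomials_bijective {ν k : ℕ} (hk : ν ≤ k + 1) :
    Function.Bijective (evalMonomials Φ L ν k) := by
  refine ⟨fun φ ψ h => symPow_hom_ext Φ hk fun b => ?_, fun ⟨h, hh⟩ => ?_⟩
  · exact congrFun (congrArg Subtype.val h) b
  · obtain ⟨φ, hφ⟩ := exists_hom_of_mem_ker_shiftMap Φ L hh
    exact ⟨φ, Subtype.ext (funext hφ)⟩

end SymmetricPower

/-! ### The two highest exterior powers of a free module -/

section TopExterior

variable {R : Type u} [CommRing R]

theorem subsingleton_exteriorPower {n m : ℕ} (h : m < n) :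
    Subsingleton (⋀[R]^n (Fin m → R)) := by
  have h1 : (LinearMap.id : ⋀[R]^n (Fin m → R) →ₗ[R] _) = 0 := by
    refine exteriorPower.linearMap_ext ((Pi.basisFun R (Fin m)).ext_alternating fun v hv => ?_)
    have := Fintype.card_le_of_injective v hv
    simp only [Fintype.card_fin] at this
    omega
  exact subsingleton_of_forall_eq 0 fun x => LinearMap.congr_fun h1 x

variable (R) in
/-- The isomorphism of the top exterior power of `R^n` with `R`. -/
def volume (n : ℕ) : ⋀[R]^n (Fin n → R) ≃ₗ[R] R :=
  LinearEquiv.ofLinearMap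
    (exteriorPower.alternatingMapLinearEquiv (Pi.basisFun R (Fin n)).det)
    (LinearMap.toSpanSingleton R _ (exteriorPower.ιMulti R n (Pi.basisFun R (Fin n))))
    (LinearMap.ext_ring (by
      rw [LinearMap.comp_apply, LinearMap.toSpanSingleton_apply, one_smul,
        exteriorPower.alternatingMapLinearEquiv_apply_ιMulti, Module.Basis.det_self,
        LinearMap.id_apply]))
    (exteriorPower.linearMap_ext ((Pi.basisFun R (Fin n)).ext_alternating fun v hv => by
      let σ : Equiv.Perm (Fin n) := Equiv.ofBijective v (Finite.injective_iff_bijective.1 hv)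
      have hσ : (fun i => Pi.basisFun R (Fin n) (v i)) = Pi.basisFun R (Fin n) ∘ σ := rfl
      rw [hσ, AlternatingMap.map_perm, AlternatingMap.map_perm]
      congr 1
      rw [LinearMap.compAlternatingMap_apply, LinearMap.comp_apply,
        exteriorPower.alternatingMapLinearEquiv_apply_ιMulti, Module.Basis.det_self,
        LinearMap.toSpanSingleton_apply, one_smul, LinearMap.compAlternatingMap_apply,
        LinearMap.id_apply]))

/-- Exterior multiplication by the basis vector `e_j`. -/
def wedge {m : ℕ} (j : Fin m) (n : ℕ) : ⋀[R]^n (Fin m → R) →ₗ[R] ⋀[R]^(n + 1) (Fin m → R) :=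
  (LinearMap.mulLeft R (ExteriorAlgebra.ι R (Pi.single j (1 : R)))).restrict fun x hx => by
    change _ ∈ LinearMap.range (ExteriorAlgebra.ι R) ^ (n + 1)
    rw [pow_succ']
    exact Submodule.mul_mem_mul ⟨_, rfl⟩ hx

theorem rowContr_ι_mul {g f : ℕ} (Φ : Matrix (Fin g) (Fin f) R) (i : Fin g) (v : Fin f → R)
    (x : ExteriorAlgebra R (Fin f → R)) : rowContr Φ i (ExteriorAlgebra.ι R v * x) =
      rowForm Φ i v • x - ExteriorAlgebra.ι R v * rowContr Φ i x :=
  CliffordAlgebra.contractLeft_ι_mul (Q := (0 : QuadraticForm R (Fin f → R)))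
    (d := rowForm Φ i) v x

theorem rowForm_one {m : ℕ} (j : Fin m) (v : Fin m → R) : rowForm 1 j v = v j := by
  simp [rowForm]

/-- Euler's identity for the exterior algebra; `rowContr 1 j` is contraction with the `j`-th
coordinate form. -/
theorem sum_ι_mul_rowContr {m : ℕ} (n : ℕ) (x : ExteriorAlgebra R (Fin m → R))
    (hx : x ∈ ⋀[R]^n (Fin m → R)) :
    ∑ j, ExteriorAlgebra.ι R (Pi.single j (1 : R)) * rowContr 1 j x = n • x := by
  induction n generalizing x with
  | zero =>
    rw [zero_smul]
    refine Finset.sum_eq_zero fun j _ => ?_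
    rw [rowContr_of_mem_zero 1 j x hx, mul_zero]
  | succ n ih =>
    replace hx : x ∈ LinearMap.range (ExteriorAlgebra.ι R) ^ (n + 1) := hx
    rw [pow_succ'] at hx
    induction hx using Submodule.mul_induction_on' with
    | mem_mul_mem a ha b hb =>
      obtain ⟨v, rfl⟩ := ha
      have h1 : ∀ j, ExteriorAlgebra.ι R (Pi.single j (1 : R)) *
          rowContr 1 j (ExteriorAlgebra.ι R v * b) =
          (v j • ExteriorAlgebra.ι R (Pi.single j (1 : R))) * b + ExteriorAlgebra.ι R v *
          (ExteriorAlgebra.ι R (Pi.single j (1 : R)) * rowContr 1 j b) := by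
        intro j
        have h3 : ExteriorAlgebra.ι R (Pi.single j (1 : R)) * ExteriorAlgebra.ι R v =
            -(ExteriorAlgebra.ι R v * ExteriorAlgebra.ι R (Pi.single j (1 : R))) :=
          eq_neg_of_add_eq_zero_left (ExteriorAlgebra.ι_add_mul_swap _ _)
        rw [rowContr_ι_mul, rowForm_one, mul_sub, mul_smul_comm, smul_mul_assoc, ← mul_assoc,
          ← mul_assoc, h3, neg_mul, sub_neg_eq_add]
      have h4 : ∑ j, v j • ExteriorAlgebra.ι R (Pi.single j (1 : R)) = ExteriorAlgebra.ι R v := by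
        conv_rhs => rw [pi_eq_sum_univ' v, map_sum]
        refine Finset.sum_congr rfl fun j _ => ?_
        rw [map_smul]
      rw [Finset.sum_congr rfl fun j _ => h1 j, Finset.sum_add_distrib, ← Finset.sum_mul, h4,
        ← Finset.mul_sum, ih b hb, mul_smul_comm, add_comm, succ_nsmul]
    | add x _ y _ hx hy =>
      simp only [map_add, mul_add, Finset.sum_add_distrib, smul_add] at hx hy ⊢
      rw [hx, hy]

/-- The linear form `y ↦ e_j ∧ y` on `⋀^n R^(n+1)`. -/
def wedgeForm (n : ℕ) (j : Fin (n + 1)) : ⋀[R]^n (Fin (n + 1) → R) →ₗ[R] R :=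
  (volume R (n + 1)).toLinearMap ∘ₗ wedge j n

/-- By the antiderivation rule and Euler's identity the sum is `(n + 1) - n` times the identity.
Hence the forms `wedgeForm n j` are jointly injective, and remain so after any tensor product. -/
theorem sum_contr_wedgeForm (n : ℕ) :
    ∑ j : Fin (n + 1), (contr 1 j n ∘ₗ (volume R (n + 1)).symm.toLinearMap) ∘ₗ wedgeForm n j =
      LinearMap.id := by
  refine LinearMap.ext fun y => ?_
  rw [LinearMap.sum_apply]
  have h1 : ∀ j, ((contr 1 j n ∘ₗ (volume R (n + 1)).symm.toLinearMap) ∘ₗ wedgeForm n j) y =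
      contr 1 j n (wedge j n y) := by
    intro j
    simp [wedgeForm]
  rw [Finset.sum_congr rfl fun j _ => h1 j]
  refine Subtype.ext ?_
  rw [AddSubmonoidClass.coe_finsetSum]
  have h2 : ∀ j, (contr 1 j n (wedge j n y)).1 = y.1 -
      ExteriorAlgebra.ι R (Pi.single j (1 : R)) * rowContr 1 j y.1 := by
    intro j
    refine (rowContr_ι_mul 1 j (Pi.single j (1 : R)) y.1).trans ?_
    rw [rowForm_one, Pi.single_eq_same, one_smul]
  rw [Finset.sum_congr rfl fun j _ => h2 j, Finset.sum_sub_distrib,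
    sum_ι_mul_rowContr n y.1 y.2, Finset.sum_const, Finset.card_univ, Fintype.card_fin,
    add_smul, one_smul, add_sub_cancel_left]
  rfl

/-- Contract the relation `e_j ∧ x = 0`, valid because `x` already has top degree. -/
theorem wedgeForm_contr {g n : ℕ} (Φ : Matrix (Fin g) (Fin (n + 1)) R) (i : Fin g)
    (j : Fin (n + 1)) (x : ⋀[R]^(n + 1) (Fin (n + 1) → R)) :
    wedgeForm n j (contr Φ i n x) = Φ i j * volume R (n + 1) x := by
  have h1 : wedge j n (contr Φ i n x) = Φ i j • x := by
    refine Subtype.ext ?_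
    have h2 := rowContr_ι_mul Φ i (Pi.single j (1 : R)) x.1
    have h3 : rowForm Φ i (Pi.single j 1) = Φ i j := by simp [rowForm]
    have h4 : wedge j (n + 1) x = 0 :=
      (subsingleton_exteriorPower (Nat.lt_succ_self (n + 1))).elim _ _
    have h5 : ExteriorAlgebra.ι R (Pi.single j (1 : R)) * x.1 = 0 := congrArg Subtype.val h4
    rw [h3, h5, map_zero] at h2
    exact (sub_eq_zero.mp h2.symm).symm
  rw [wedgeForm, LinearMap.comp_apply, h1, LinearEquiv.coe_coe, map_smul, smul_eq_mul]

end TopExterior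

/-! ### The kernel of the top differential -/

section TopKernel

variable {R : Type u} [CommRing R] (L : Type u) [AddCommGroup L] [Module R L]

/-- `invComp R g ν k` as finitely supported functions on exponents. -/
def invCompEquiv (g ν k : ℕ) : invComp R g ν k ≃ₗ[R] (Exponents g ν k →₀ R) :=
  Finsupp.supportedEquivFinsupp {b : Fin g →₀ ℕ | b.degree + ν = k}

variable (R) in
/-- `invComp R g ν k ⊗ L` as functions on exponents. -/
def invCompTensorEquiv (g ν k : ℕ) :
    (R ⊗[R] invComp R g ν k) ⊗[R] L ≃ₗ[R] (Exponents g ν k → L) :=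
  (TensorProduct.congr ((TensorProduct.lid R _).trans (invCompEquiv g ν k))
    (LinearEquiv.refl R L)).trans
    ((TensorProduct.finsuppScalarLeft R L (Exponents g ν k)).trans
      (Finsupp.linearEquivFunOnFinite R L (Exponents g ν k)))

theorem invCompTensorEquiv_tmul (g ν k : ℕ) (r : R) (h : invComp R g ν k) (l : L)
    (b : Exponents g ν k) :
    invCompTensorEquiv R L g ν k ((r ⊗ₜ h) ⊗ₜ l) b = (r * h.1 b.1) • l := by
  simp only [invCompTensorEquiv, LinearEquiv.trans_apply, TensorProduct.congr_tmul,
    TensorProduct.lid_tmul, LinearEquiv.refl_apply]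
  refine (TensorProduct.finsuppScalarLeft_apply_tmul_apply _ _ _).trans ?_
  rw [map_smul]
  rfl

variable {g k : ℕ} (Φ : Matrix (Fin g) (Fin (g + k + 1)) R)

variable (R g k) in
/-- `K_f(γ, H)_ν ⊗ L` as functions on exponents. -/
def topEquiv (ν : ℕ) : KH R g (g + k + 1) ν (k + 1) ⊗[R] L ≃ₗ[R] (Exponents g ν (k + 1) → L) :=
  (TensorProduct.congr (TensorProduct.congr (volume R (g + k + 1)) (LinearEquiv.refl R _))
    (LinearEquiv.refl R L)).trans (invCompTensorEquiv R L g ν (k + 1))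

variable (R g k) in
/-- The components of an embedding of `K_(f-1)(γ, H)_ν ⊗ L` into functions on exponents. -/
def subtopMap (ν : ℕ) (j : Fin (g + k + 1)) :
    KH R g (g + k + 1) ν k ⊗[R] L →ₗ[R] (Exponents g ν k → L) :=
  (invCompTensorEquiv R L g ν k).toLinearMap ∘ₗ
    ((wedgeForm (g + k) j).rTensor (invComp R g ν k)).rTensor L

theorem eq_zero_of_subtopMap_eq_zero (ν : ℕ) (z : KH R g (g + k + 1) ν k ⊗[R] L)
    (hz : ∀ j, subtopMap R L g k ν j z = 0) : z = 0 := by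
  have h1 : ∀ j, ((wedgeForm (g + k) j).rTensor (invComp R g ν k)).rTensor L z = 0 := fun j =>
    (invCompTensorEquiv R L g ν k).map_eq_zero_iff.mp (hz j)
  have h2 : ((LinearMap.id : ⋀[R]^(g + k) (Fin (g + k + 1) → R) →ₗ[R] _).rTensor
      (invComp R g ν k)).rTensor L z = 0 := by
    rw [← sum_contr_wedgeForm (g + k), ← LinearMap.coe_rTensorHom, ← LinearMap.coe_rTensorHom,
      map_sum, map_sum, LinearMap.sum_apply]
    refine Finset.sum_eq_zero fun j _ => ?_
    rw [LinearMap.coe_rTensorHom, LinearMap.coe_rTensorHom, LinearMap.rTensor_comp,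
      LinearMap.rTensor_comp, LinearMap.comp_apply, h1, map_zero]
  rwa [LinearMap.rTensor_id, LinearMap.rTensor_id] at h2

theorem subtopMap_dH (ν : ℕ) (j : Fin (g + k + 1))
    (z : KH R g (g + k + 1) ν (k + 1) ⊗[R] L) :
    subtopMap R L g k ν j ((dH Φ ν k).rTensor L z) =
      shiftMap Φ L ν k (topEquiv R L g k ν z) j := by
  refine LinearMap.congr_fun (f := subtopMap R L g k ν j ∘ₗ (dH Φ ν k).rTensor L)
    (g := LinearMap.proj j ∘ₗ shiftMap Φ L ν k ∘ₗ (topEquiv R L g k ν).toLinearMap)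
    (TensorProduct.ext_threefold fun x h l => funext fun b => ?_) z
  have h1 : topEquiv R L g k ν ((x ⊗ₜ h) ⊗ₜ l) = invCompTensorEquiv R L g ν (k + 1)
      ((volume R (g + k + 1) x ⊗ₜ h) ⊗ₜ l) := rfl
  simp only [LinearMap.comp_apply, LinearEquiv.coe_coe, h1, LinearMap.proj_apply]
  change _ = ∑ i, Φ i j • invCompTensorEquiv R L g ν (k + 1)
      ((volume R (g + k + 1) x ⊗ₜ h) ⊗ₜ l) (b.up i)
  simp only [LinearMap.rTensor_tmul, dH, LinearMap.sum_apply, TensorProduct.map_tmul,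
    TensorProduct.sum_tmul, map_sum, subtopMap, LinearMap.comp_apply, LinearEquiv.coe_coe,
    Finset.sum_apply, invCompTensorEquiv_tmul, wedgeForm_contr]
  refine Finset.sum_congr rfl fun i _ => ?_
  rw [smul_smul, ← mul_assoc]
  rfl

/-- In the coordinates given by the volume form on the source and the wedge forms on the target, the
top differential becomes `shiftMap`; joint injectivity of the wedge forms makes the kernels agree.
-/
theorem nonempty_ker_dH_equiv (ν : ℕ) : Nonempty (LinearMap.ker ((dH Φ ν k).rTensor L) ≃ₗ[R]
    LinearMap.ker (shiftMap Φ L ν k)) := by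
  have h : LinearMap.ker ((dH Φ ν k).rTensor L) =
      (LinearMap.ker (shiftMap Φ L ν k)).comap (topEquiv R L g k ν).toLinearMap := by
    ext z
    rw [Submodule.mem_comap, LinearMap.mem_ker, LinearMap.mem_ker, LinearEquiv.coe_coe]
    refine ⟨fun hz => funext fun j => ?_, fun hz => ?_⟩
    · rw [← subtopMap_dH, hz, map_zero]
      rfl
    · refine eq_zero_of_subtopMap_eq_zero L ν _ fun j => ?_
      rw [subtopMap_dH, hz]
      rfl
  exact ⟨(LinearEquiv.ofEq _ _ h).trans ((topEquiv R L g k ν).ofSubmodule' _)⟩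

end TopKernel

/-! ### Identification of the top homology -/

section TopHomology

variable {R : Type u} [CommRing R]

theorem nonempty_homology_equiv_ker (K : ChainComplex (ModuleCat.{u} R) ℕ) (m : ℕ)
    (h : Subsingleton (K.X (m + 2))) :
    Nonempty (K.homology (m + 1) ≃ₗ[R] LinearMap.ker (K.d (m + 1) m).hom) := by
  let e := (ShortComplex.homologyMapIso (K.isoSc' (m + 2) (m + 1) m (by simp) (by simp))) ≪≫
    (K.sc' (m + 2) (m + 1) m).moduleCatHomologyIso
  have hr : LinearMap.range (K.sc' (m + 2) (m + 1) m).moduleCatToCycles = ⊥ := by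
    refine (Submodule.eq_bot_iff _).mpr ?_
    rintro _ ⟨x, rfl⟩
    have h0 : x = 0 := @Subsingleton.elim _ h x 0
    rw [h0, map_zero]
  exact ⟨e.toLinearEquiv.trans (Submodule.quotEquivOfEqBot _ hr)⟩

variable {g k : ℕ} (Φ : Matrix (Fin g) (Fin (g + k + 1)) R)

theorem subsingleton_KS {f ν m : ℕ} (h : ν < m) : Subsingleton (KS R g f ν m) := by
  have h1 : Subsingleton (polyComp R g ν m) := by
    refine subsingleton_of_forall_eq 0 fun p => Subtype.ext (MvPolynomial.ext _ _ fun a => ?_)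
    by_contra ha
    have h2 := p.2 (MvPolynomial.mem_support_iff.mpr ha)
    rw [Set.mem_ofPred_eq] at h2
    omega
  infer_instance

/-- Since `ν ≤ k`, the polynomial summands in both positions involved vanish. -/
theorem nonempty_ker_complexD_equiv (L : Type u) [AddCommGroup L] [Module R L] {ν : ℕ}
    (hν : ν ≤ k) : Nonempty (LinearMap.ker ((complexD Φ ν (k + 1)).hom.rTensor L) ≃ₗ[R]
      LinearMap.ker ((dH Φ ν k).rTensor L)) := by
  have h1 : Subsingleton (KS R g (g + k + 1) ν (k + 2)) := subsingleton_KS (by omega)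
  have h2 : Subsingleton (KS R g (g + k + 1) ν (k + 1)) := subsingleton_KS (by omega)
  let e1 : (KS R g (g + k + 1) ν (k + 2) × KH R g (g + k + 1) ν (k + 1)) ≃ₗ[R]
      KH R g (g + k + 1) ν (k + 1) := LinearEquiv.ofBijective (LinearMap.snd R _ _)
    ⟨fun a b hab => Prod.ext (Subsingleton.elim _ _) hab, LinearMap.snd_surjective⟩
  let e2 : (KS R g (g + k + 1) ν (k + 1) × KH R g (g + k + 1) ν k) ≃ₗ[R]
      KH R g (g + k + 1) ν k := LinearEquiv.ofBijective (LinearMap.snd R _ _)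
    ⟨fun a b hab => Prod.ext (Subsingleton.elim _ _) hab, LinearMap.snd_surjective⟩
  let d : (KS R g (g + k + 1) ν (k + 2) × KH R g (g + k + 1) ν (k + 1)) →ₗ[R]
      (KS R g (g + k + 1) ν (k + 1) × KH R g (g + k + 1) ν k) := (complexD Φ ν (k + 1)).hom
  have h3 : ∀ z, e2.rTensor L (d.rTensor L z) =
      (dH Φ ν k).rTensor L (e1.rTensor L z) := fun z =>
    LinearMap.congr_fun (f := (e2.rTensor L).toLinearMap ∘ₗ d.rTensor L)
      (g := (dH Φ ν k).rTensor L ∘ₗ (e1.rTensor L).toLinearMap)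
      (TensorProduct.ext' fun _ _ => rfl) z
  have h : LinearMap.ker (d.rTensor L) =
      (LinearMap.ker ((dH Φ ν k).rTensor L)).comap (e1.rTensor L).toLinearMap := by
    ext z
    rw [Submodule.mem_comap, LinearMap.mem_ker, LinearMap.mem_ker, LinearEquiv.coe_coe, ← h3,
      LinearEquiv.map_eq_zero_iff]
  exact ⟨(LinearEquiv.ofEq _ _ h).trans ((e1.rTensor L).ofSubmodule' _)⟩

theorem nonempty_topHomology_equiv (L : Type u) [AddCommGroup L] [Module R L] {ν : ℕ}
    (hν : ν ≤ k) : Nonempty ((complexTensor Φ L ν).homology (k + 2) ≃ₗ[R]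
      (SymPow R (k + 1 - ν) (Coker Φ) →ₗ[R] L)) := by
  have hX : Subsingleton (complexX R g (g + k + 1) ν (k + 3)) := by
    have h1 : Subsingleton (KS R g (g + k + 1) ν (k + 3)) := subsingleton_KS (by omega)
    have h2 : Subsingleton (⋀[R]^(g + (k + 2)) (Fin (g + k + 1) → R)) :=
      subsingleton_exteriorPower (by omega)
    exact inferInstanceAs (Subsingleton (KS R g (g + k + 1) ν (k + 3) ×
      KH R g (g + k + 1) ν (k + 2)))
  have hY : Subsingleton ((complexTensor Φ L ν).X (k + 3)) :=
    inferInstanceAs (Subsingleton (complexX R g (g + k + 1) ν (k + 3) ⊗[R] L))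
  obtain ⟨e1⟩ := nonempty_homology_equiv_ker (complexTensor Φ L ν) (k + 1) hY
  have hd : ((complexTensor Φ L ν).d (k + 2) (k + 1)).hom =
      (complexD Φ ν (k + 1)).hom.rTensor L := by
    rw [← complex_d]
    rfl
  obtain ⟨e2⟩ := nonempty_ker_complexD_equiv Φ L hν
  obtain ⟨e3⟩ := nonempty_ker_dH_equiv L Φ ν
  have e4 := LinearEquiv.ofBijective _ (evalMonomials_bijective Φ L (ν := ν) (k := k) (by omega))
  exact ⟨e1.trans ((LinearEquiv.ofEq _ _ (congrArg LinearMap.ker hd)).trans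
    (e2.trans (e3.trans e4.symm)))⟩

end TopHomology

/-! ### Maximal minors, the cokernel and its symmetric powers -/

section Minors

variable {R : Type u} [CommRing R] {g f : ℕ} (Φ : Matrix (Fin g) (Fin f) R)

theorem det_submatrix_mem_minorsIdeal (s : Fin g → Fin f) :
    (Φ.submatrix id s).det ∈ minorsIdeal Φ := by
  by_cases hs : Function.Injective s
  · have h1 : StrictMono (s ∘ Tuple.sort s) :=
      (Tuple.monotone_sort s).strictMono_of_injective (hs.comp (Tuple.sort s).injective)
    have h2 := Matrix.det_permute' (Tuple.sort s) (Φ.submatrix id s)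
    have h3 : (Φ.submatrix id (s ∘ Tuple.sort s)).det ∈ minorsIdeal Φ :=
      Ideal.subset_span ⟨OrderEmbedding.ofStrictMono _ h1, rfl⟩
    rw [Matrix.submatrix_submatrix] at h2
    change (Φ.submatrix id (s ∘ Tuple.sort s)).det = _ at h2
    have h4 : (Φ.submatrix id s).det = ((Equiv.Perm.sign (Tuple.sort s) : ℤ) : R) *
        (Φ.submatrix id (s ∘ Tuple.sort s)).det := by
      rw [h2, ← mul_assoc, ← Int.cast_mul, Int.units_coe_mul_self, Int.cast_one, one_mul]
    rw [h4]
    exact Ideal.mul_mem_left _ _ h3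
  · obtain ⟨a, b, hab, hne⟩ : ∃ a b, s a = s b ∧ a ≠ b := by
      simpa [Function.Injective] using hs
    rw [Matrix.det_zero_of_column_eq hne fun i => by simp [hab]]
    exact zero_mem _

/-- A substitute for Cauchy–Binet: modulo the minors, the determinant is an alternating form in the
columns of `B` that vanishes on tuples of basis vectors. -/
theorem det_mul_mem_minorsIdeal (B : Matrix (Fin f) (Fin g) R) :
    (Φ * B).det ∈ minorsIdeal Φ := by
  let D : (Fin f → R) [⋀^Fin g]→ₗ[R] R := Matrix.detRowAlternating.compLinearMap Φ.mulVecLin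
  have h1 : (minorsIdeal Φ).mkQ.compAlternatingMap D = 0 := by
    refine (Pi.basisFun R (Fin f)).ext_alternating fun s _ => ?_
    have h2 : D (fun i => Pi.basisFun R (Fin f) (s i)) = (Φ.submatrix id s).det := by
      rw [← Matrix.det_transpose]
      change Matrix.det _ = _
      congr 1
      ext i j
      simp
    rw [LinearMap.compAlternatingMap_apply, h2]
    exact (Submodule.Quotient.mk_eq_zero _).mpr (det_submatrix_mem_minorsIdeal Φ s)
  have h3 : D B.transpose = (Φ * B).det := by
    rw [← Matrix.det_transpose]
    rfl
  rw [← h3]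
  exact (Submodule.Quotient.mk_eq_zero _).mp (congrArg (fun T => T B.transpose) h1)

/-- If `r` kills the cokernel, each `r e_i` lies in the image of `Φ`, so `Φ V = r` for some `V`;
take determinants. -/
theorem pow_mem_minorsIdeal {r : R} (hr : r ∈ Module.annihilator R (Coker Φ)) :
    r ^ g ∈ minorsIdeal Φ := by
  have h1 : ∀ i : Fin g, ∃ v, Φ.mulVec v = r • Pi.single i 1 := by
    intro i
    have h2 := Module.mem_annihilator.mp hr (Submodule.Quotient.mk (Pi.single i 1))
    rw [← Submodule.Quotient.mk_smul, Submodule.Quotient.mk_eq_zero] at h2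
    exact h2
  choose v hv using h1
  have h2 : Φ * (Matrix.of v).transpose = r • 1 := by
    ext i j
    have h3 := congrFun (hv j) i
    rw [Matrix.mulVec, dotProduct] at h3
    rw [Matrix.mul_apply]
    refine h3.trans ?_
    rw [Pi.smul_apply, Matrix.smul_apply, Matrix.one_apply, Pi.single_apply]
  have h3 := det_mul_mem_minorsIdeal Φ (Matrix.of v).transpose
  rwa [h2, Matrix.det_smul, Matrix.det_one, mul_one, Fintype.card_fin] at h3

theorem smul_coker_eq_zero {x : R} (hx : x ∈ minorsIdeal Φ) (m : Coker Φ) : x • m = 0 := by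
  suffices h : minorsIdeal Φ ≤ Module.annihilator R (Coker Φ) from
    Module.mem_annihilator.mp (h hx) m
  refine Ideal.span_le.mpr ?_
  rintro _ ⟨s, rfl⟩
  refine Module.mem_annihilator.mpr fun m => ?_
  obtain ⟨v, rfl⟩ := Submodule.Quotient.mk_surjective _ m
  obtain ⟨B, hB⟩ := exists_mul_eq_diagonal_det Φ s
  rw [← Submodule.Quotient.mk_smul, Submodule.Quotient.mk_eq_zero]
  refine ⟨B.mulVec v, ?_⟩
  rw [Matrix.mulVecLin_apply, Matrix.mulVec_mulVec, hB]
  ext i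
  rw [Matrix.mulVec_diagonal]
  rfl

theorem smul_symPow_eq_zero {N : Type u} [AddCommGroup N] [Module R N] {x : R}
    (hx : ∀ n : N, x • n = 0) (t : ℕ) (z : SymPow R (t + 1) N) : x • z = 0 := by
  refine Subtype.ext ?_
  obtain ⟨z, hz⟩ := z
  change x • z = 0
  replace hz : z ∈ LinearMap.range (SymmetricAlgebra.ι R N) ^ (t + 1) := hz
  rw [pow_succ'] at hz
  induction hz using Submodule.mul_induction_on' with
  | mem_mul_mem a ha b hb =>
    obtain ⟨v, rfl⟩ := ha
    rw [← smul_mul_assoc, ← map_smul, hx, map_zero, zero_mul]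
  | add a _ b _ ha hb => rw [smul_add, ha, hb, add_zero]

/-- The algebra map extending `φ` sends the power `n ^ t` to `φ n ^ t`, which is nonzero in a
domain. -/
theorem exists_symPow_linearMap_ne_zero {N A : Type u} [AddCommGroup N] [Module R N] [CommRing A]
    [IsDomain A] [Algebra R A] [Nontrivial (N →ₗ[R] A)] (t : ℕ) :
    Nontrivial (SymPow R t N →ₗ[R] A) := by
  obtain ⟨φ, hφ⟩ := exists_ne (0 : N →ₗ[R] A)
  obtain ⟨n, hn⟩ := DFunLike.ne_iff.mp hφ
  refine nontrivial_of_ne ((SymmetricAlgebra.lift φ).toLinearMap ∘ₗ (SymPow R t N).subtype) 0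
    fun h => ?_
  have h1 := LinearMap.congr_fun h 
    ⟨SymmetricAlgebra.ι R N n ^ t, Submodule.pow_mem_pow _ (LinearMap.mem_range_self _ n) t⟩
  change SymmetricAlgebra.lift φ (SymmetricAlgebra.ι R N n ^ t) = 0 at h1
  rw [map_pow, SymmetricAlgebra.lift_ι_apply] at h1
  exact hn (eq_zero_of_pow_eq_zero h1)

theorem minorsIdeal_le_radical : minorsIdeal Φ ≤ (minorsPowIdeal Φ).radical := by
  refine Ideal.span_le.mpr ?_
  rintro _ ⟨s, rfl⟩
  exact ⟨g, Ideal.subset_span ⟨s, rfl⟩⟩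

theorem minorsPowIdeal_le [Nontrivial (Coker Φ)] : minorsPowIdeal Φ ≤ minorsIdeal Φ := by
  -- For `g = 0` the zeroth power of a minor would be `1`; a nonzero cokernel excludes this.
  have hg : g ≠ 0 := by
    rintro rfl
    exact not_subsingleton (Coker Φ) inferInstance
  refine Ideal.span_le.mpr ?_
  rintro _ ⟨s, rfl⟩
  exact Ideal.pow_mem_of_mem _ (Ideal.subset_span (Set.mem_range_self s)) _ (Nat.pos_of_ne_zero hg)

/-- `Hom(M, R/p)` vanishes only if some annihilator `r` of `M` is regular on `R/p`, but `r ^ g` is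
in the minors ideal, so `r` is in `p`. -/
theorem nontrivial_symPow_linearMap [IsNoetherianRing R] {p : Ideal R} [p.IsPrime]
    (hp : minorsIdeal Φ ≤ p) (t : ℕ) : Nontrivial (SymPow R t (Coker Φ) →ₗ[R] R ⧸ p) := by
  have h : Nontrivial (Coker Φ →ₗ[R] R ⧸ p) := by
    rw [← not_subsingleton_iff_nontrivial, IsSMulRegular.subsingleton_linearMap_iff]
    rintro ⟨r, hr, hreg⟩
    have h1 : r ∈ p := Ideal.IsPrime.mem_of_pow_mem ‹_› g (hp (pow_mem_minorsIdeal Φ hr))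
    have h2 : (1 : R ⧸ p) = 0 := hreg (by
      change r • (1 : R ⧸ p) = r • 0
      rw [smul_zero, Algebra.smul_def, mul_one]
      exact Ideal.Quotient.eq_zero_iff_mem.mpr h1)
    exact one_ne_zero h2
  exact exists_symPow_linearMap_ne_zero t

theorem minorsIdeal_smul_top_ne_top (L : Type u) [AddCommGroup L] [Module R L]
    (h : Nontrivial (Coker Φ ⊗[R] L)) : minorsIdeal Φ • (⊤ : Submodule R L) ≠ ⊤ := by
  intro htop
  have h1 : ∀ (m : Coker Φ), ∀ l ∈ minorsIdeal Φ • (⊤ : Submodule R L), m ⊗ₜ[R] l = 0 := by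
    intro m l hl
    induction hl using Submodule.smul_induction_on' with
    | smul x hx l _ =>
      rw [← TensorProduct.smul_tmul, smul_coker_eq_zero Φ hx, TensorProduct.zero_tmul]
    | add a _ b _ ha hb => rw [TensorProduct.tmul_add, ha, hb, add_zero]
  refine not_subsingleton (Coker Φ ⊗[R] L) (subsingleton_of_forall_eq 0 fun z => ?_)
  induction z with
  | zero => rfl
  | tmul m l => exact h1 m l (by rw [htop]; trivial)
  | add a b ha hb => rw [ha, hb, add_zero]

end Minors

/-! ### Maximal regular sequences and associated primes -/

section MaximalSequence

variable {R : Type u} [CommRing R] {L : Type u} [AddCommGroup L] [Module R L]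

open RingTheory.Sequence

/-- Maximise the submodule `(rs)L` rather than the length. If a regular `x` could be appended
without enlarging it, `x` would be both zero and injective on `L/(rs)L`, forcing `(rs)L = L` and so
`JL = L`. -/
theorem exists_maximal_isWeaklyRegular [IsNoetherian R L] {J : Ideal R}
    (hJ : J • (⊤ : Submodule R L) ≠ ⊤) :
    ∃ rs : List R, (∀ r ∈ rs, r ∈ J) ∧ IsWeaklyRegular L rs ∧
      ∀ x ∈ J, ¬ IsSMulRegular (L ⧸ (Ideal.ofList rs • ⊤ : Submodule R L)) x := by
  obtain ⟨_, ⟨rs, ⟨hrs, hreg⟩, rfl⟩, hmax⟩ := set_has_maximal_iff_noetherian.mpr ‹IsNoetherian R L›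
    ((fun rs : List R => (Ideal.ofList rs • ⊤ : Submodule R L)) ''
      {rs | (∀ r ∈ rs, r ∈ J) ∧ IsWeaklyRegular L rs})
    ⟨_, [], ⟨by simp, .nil R L⟩, rfl⟩
  refine ⟨rs, hrs, hreg, fun x hx hxreg => ?_⟩
  have hle : (Ideal.ofList rs • ⊤ : Submodule R L) ≤ Ideal.ofList (rs ++ [x]) • ⊤ :=
    Submodule.smul_mono_left (by rw [Ideal.ofList_append]; exact le_sup_left)
  have h1 := hmax _ ⟨rs ++ [x], ⟨by simpa [or_imp, forall_and] using ⟨hrs, hx⟩,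
    (isWeaklyRegular_append_iff _ _ _).mpr ⟨hreg, (isWeaklyRegular_singleton_iff _ _).mpr hxreg⟩⟩,
    rfl⟩
  have h2 : (Ideal.ofList (rs ++ [x]) • ⊤ : Submodule R L) ≤ Ideal.ofList rs • ⊤ := by
    by_contra h3
    exact h1 (lt_of_le_not_ge hle h3)
  have h4 : Subsingleton (L ⧸ (Ideal.ofList rs • ⊤ : Submodule R L)) := by
    refine subsingleton_of_isSMulRegular hxreg fun z => ?_
    obtain ⟨l, rfl⟩ := Submodule.Quotient.mk_surjective _ z
    rw [← Submodule.Quotient.mk_smul, Submodule.Quotient.mk_eq_zero]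
    refine h2 (Submodule.smul_mem_smul ?_ trivial)
    exact Ideal.subset_span (by simp)
  rw [Submodule.Quotient.subsingleton_iff] at h4
  exact hJ (top_le_iff.mp (h4.ge.trans (Submodule.smul_mono_left (Ideal.span_le.mpr hrs))))

/-- The zero divisors on `L` are the union of finitely many associated primes, so prime avoidance
puts `J` inside one of them. -/
theorem exists_prime_linearMap_injective [IsNoetherianRing R] [Module.Finite R L] [Nontrivial L]
    {J : Ideal R} (hJ : ∀ x ∈ J, ¬ IsSMulRegular L x) :
    ∃ p : Ideal R, p.IsPrime ∧ J ≤ p ∧ ∃ φ : R ⧸ p →ₗ[R] L, Function.Injective φ := by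
  obtain ⟨p, hp, hle⟩ : ∃ p ∈ associatedPrimes R L, J ≤ p := by
    obtain ⟨q, _⟩ := associatedPrimes.nonempty R L
    refine (Ideal.subset_union_prime_finite (associatedPrimes.finite R L) q q
      fun I hI _ _ => IsAssociatedPrime.isPrime hI).mp ?_
    rw [biUnion_associatedPrimes_eq_compl_regular R L]
    exact hJ
  obtain ⟨h1, h2⟩ := (isAssociatedPrime_iff_exists_injective_linearMap _ _).mp hp
  exact ⟨p, h1, hle, h2⟩

end MaximalSequence

/-! ### Vanishing above the top and the value of the grade -/

section Grade

variable {R : Type u} [CommRing R] (L : Type u) [AddCommGroup L] [Module R L]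

open RingTheory.Sequence

theorem subsingleton_homology_of_lt {g k ν n : ℕ} (Φ : Matrix (Fin g) (Fin (g + k + 1)) R)
    (hν : ν ≤ k) (hn : k + 2 < n) : Subsingleton ((complexTensor Φ L ν).homology n) := by
  obtain ⟨m, rfl⟩ : ∃ m, n = m + 1 := ⟨n - 1, by omega⟩
  have h1 : Subsingleton (KS R g (g + k + 1) ν (m + 1)) := subsingleton_KS (by omega)
  have h2 : Subsingleton (⋀[R]^(g + m) (Fin (g + k + 1) → R)) :=
    subsingleton_exteriorPower (by omega)
  have h3 : Subsingleton (complexX R g (g + k + 1) ν (m + 1)) :=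
    inferInstanceAs (Subsingleton (KS R g (g + k + 1) ν (m + 1) × KH R g (g + k + 1) ν m))
  have h4 : Subsingleton ((complexTensor Φ L ν).X (m + 1)) :=
    inferInstanceAs (Subsingleton (complexX R g (g + k + 1) ν (m + 1) ⊗[R] L))
  have h5 : Limits.IsZero ((complexTensor Φ L ν).homology (m + 1)) :=
    ShortComplex.isZero_homology_of_isZero_X₂ _ (ModuleCat.isZero_of_iff_subsingleton.mpr h4)
  exact ModuleCat.subsingleton_of_isZero h5

theorem isShiftSequence_topHomology_symPow {g k ν : ℕ} (Φ : Matrix (Fin g) (Fin (g + k + 1)) R)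
    (hν : ν ≤ k) : IsShiftSequence (topHomology Φ ν (k + 2)) (minorsPowIdeal Φ)
      (SymPow R (k + 1 - ν) (Coker Φ)) :=
  isShiftSequence_topHomology Φ ν (k + 2) _ fun L => nonempty_topHomology_equiv Φ L hν

/-- A longer regular sequence in the minors ideal would force the homology at index `rs.length` to
vanish. -/
theorem grade_eq {g k ν : ℕ} (Φ : Matrix (Fin g) (Fin (g + k + 1)) R) (hν : ν ≤ k)
    (hML : Nontrivial (Coker Φ ⊗[R] L)) {rs : List R} (hrs : ∀ r ∈ rs, r ∈ minorsIdeal Φ)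
    (hreg : IsRegular L rs)
    (hnt : Nontrivial (topHomology Φ ν (k + 2) rs.length (ModuleCat.of R L))) :
    grade (minorsIdeal Φ) L = (rs.length : ℕ∞) := by
  rw [grade, if_neg (minorsIdeal_smul_top_ne_top Φ L hML)]
  refine le_antisymm (iSup_le ?_) (le_iSup_of_le ⟨rs, hrs, hreg⟩ le_rfl)
  rintro ⟨rs', hrs', hreg'⟩
  by_contra! h
  have h1 := (isShiftSequence_topHomology_symPow Φ hν).subsingleton_of_isWeaklyRegular rs'
    (fun r hr => minorsIdeal_le_radical Φ (hrs' r hr)) (ModuleCat.of R L)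
    hreg'.toIsWeaklyRegular rs.length (by exact_mod_cast h)
  exact not_nontrivial_iff_subsingleton.mpr h1 hnt

end Grade

/-! ### Nonvanishing at the end of a maximal sequence -/

section Main

variable {R : Type u} [CommRing R] [IsNoetherianRing R] {g f : ℕ} (Φ : Matrix (Fin g) (Fin f) R)
  (L : Type u) [AddCommGroup L] [Module R L] [Module.Finite R L]

open RingTheory.Sequence

/-- A maximal regular sequence `rs` on `L` in the ideal of the `g`-th powers of the minors. -/
theorem exists_isRegular_nontrivial_linearMap (hML : Nontrivial (Coker Φ ⊗[R] L)) (t : ℕ) :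
    ∃ rs : List R, (∀ r ∈ rs, r ∈ minorsPowIdeal Φ) ∧ (∀ r ∈ rs, r ∈ minorsIdeal Φ) ∧
      IsRegular L rs ∧ Nontrivial (SymPow R t (Coker Φ) →ₗ[R]
        L ⧸ (Ideal.ofList rs • ⊤ : Submodule R L)) := by
  have hM : Nontrivial (Coker Φ) := by
    by_contra h
    have := not_nontrivial_iff_subsingleton.mp h
    exact not_subsingleton (Coker Φ ⊗[R] L) inferInstance
  have hI := minorsIdeal_smul_top_ne_top Φ L hML
  have hJI := minorsPowIdeal_le Φ
  have hJ : minorsPowIdeal Φ • (⊤ : Submodule R L) ≠ ⊤ := fun h =>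
    hI (top_le_iff.mp (h.ge.trans (Submodule.smul_mono_left hJI)))
  obtain ⟨rs, hrs, hreg, hmax⟩ := exists_maximal_isWeaklyRegular hJ
  have hne : (Ideal.ofList rs • ⊤ : Submodule R L) ≠ ⊤ := fun h =>
    hJ (top_le_iff.mp (h.ge.trans (Submodule.smul_mono_left (Ideal.span_le.mpr hrs))))
  have : Nontrivial (L ⧸ (Ideal.ofList rs • ⊤ : Submodule R L)) :=
    Submodule.Quotient.nontrivial_iff.mpr hne
  obtain ⟨p, hp, hle, φ, hφ⟩ := exists_prime_linearMap_injective hmax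
  refine ⟨rs, hrs, fun r hr => hJI (hrs r hr), ⟨hreg, hne.symm⟩, ?_⟩
  have := nontrivial_symPow_linearMap Φ
    ((minorsIdeal_le_radical Φ).trans (hp.radical_le_iff.mpr hle)) t
  obtain ⟨ψ, hψ⟩ := exists_ne (0 : SymPow R t (Coker Φ) →ₗ[R] R ⧸ p)
  refine nontrivial_of_ne (φ ∘ₗ ψ) 0 fun h => hψ (LinearMap.ext fun z => hφ ?_)
  rw [LinearMap.zero_apply, map_zero]
  exact LinearMap.congr_fun h z

end Main

end

end BuchsbaumEisenbud

theorem mainTheorem5 {R : Type u} [CommRing R] [IsNoetherianRing R] {g f : ℕ}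
    (Φ : Matrix (Fin g) (Fin f) R) (L : Type u) [AddCommGroup L] [Module R L] [Module.Finite R L]
    (hML : Nontrivial (BuchsbaumEisenbud.Coker Φ ⊗[R] L)) (ν : ℕ) (hν : ν + g < f) :
    ∃ 𝔤 : ℕ,
      BuchsbaumEisenbud.grade (BuchsbaumEisenbud.minorsIdeal Φ) L = (𝔤 : ℕ∞) ∧
      IsLeast {i : ℤ | ∃ n : ℕ, (n : ℤ) = (f : ℤ) - (g : ℤ) + 1 - i ∧
        Nontrivial ((BuchsbaumEisenbud.complexTensor Φ L ν).homology n)} (𝔤 : ℤ) ∧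
      Nonempty ((BuchsbaumEisenbud.complexTensor Φ L ν).homology (f - g + 1 - 𝔤) ≃ₗ[R]
        CategoryTheory.Abelian.Ext
          (ModuleCat.of R (BuchsbaumEisenbud.SymPow R (f - g - ν) (BuchsbaumEisenbud.Coker Φ)))
          (ModuleCat.of R L) 𝔤) := by
  open BuchsbaumEisenbud in
  obtain ⟨k, rfl⟩ : ∃ k, f = g + k + 1 := ⟨f - g - 1, by omega⟩
  have hk : ν ≤ k := by omega
  obtain ⟨rs, hJ, hI, hreg, hnt⟩ :=
    exists_isRegular_nontrivial_linearMap Φ L hML (k + 1 - ν)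
  have hF := isShiftSequence_topHomology_symPow Φ hk
  have hsub := hF.subsingleton_of_isWeaklyRegular rs (fun r hr => Ideal.le_radical (hJ r hr))
    (ModuleCat.of R L) hreg.toIsWeaklyRegular
  obtain ⟨e1⟩ := hF.nonempty_equiv_of_isWeaklyRegular rs hJ (ModuleCat.of R L)
    hreg.toIsWeaklyRegular
  have htop : Nontrivial (topHomology Φ ν (k + 2) rs.length (ModuleCat.of R L)) :=
    e1.toEquiv.nontrivial
  have hle : rs.length ≤ k + 2 := by
    by_contra h
    rw [topHomology_of_not_le Φ ν h] at htop
    exact not_subsingleton PUnit.{u + 1} inferInstance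
  have hSym : ∀ x ∈ minorsPowIdeal Φ, ∀ z : SymPow R (k + 1 - ν) (Coker Φ), x • z = 0 := by
    intro x hx
    have hM : Nontrivial (Coker Φ) := by
      by_contra h
      have := not_nontrivial_iff_subsingleton.mp h
      exact not_subsingleton (Coker Φ ⊗[R] L) inferInstance
    -- The exponent is positive because `ν < f - g`; the zeroth symmetric power need not be killed.
    rw [show k + 1 - ν = k - ν + 1 by omega]
    exact smul_symPow_eq_zero (smul_coker_eq_zero Φ (minorsPowIdeal_le Φ hx)) _
  obtain ⟨e2⟩ := (isShiftSequence_ext (minorsPowIdeal Φ) (SymPow R (k + 1 - ν) (Coker Φ)) hSym).nonempty_equiv_of_isWeaklyRegular rs hJ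
    (ModuleCat.of R L) hreg.toIsWeaklyRegular
  refine ⟨rs.length, grade_eq L Φ hk hML hI hreg htop, ⟨⟨k + 2 - rs.length, by omega, ?_⟩, ?_⟩, ?_⟩
  · rwa [topHomology_of_le Φ ν hle] at htop
  · rintro i ⟨n, hn, hnn⟩
    by_contra! hi
    -- The index `i` ranges over the integers; a negative one corresponds to a position above the
    -- top of the complex.
    by_cases h : k + 2 < n
    · exact not_nontrivial_iff_subsingleton.mpr (subsingleton_homology_of_lt L Φ hk h) hnn
    · have h1 := hsub (k + 2 - n) (by omega)
      rw [topHomology_of_le Φ ν (by omega), show k + 2 - (k + 2 - n) = n by omega] at h1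
      exact not_nontrivial_iff_subsingleton.mpr h1 hnn
  · rw [topHomology_of_le Φ ν hle] at e1
    rw [show g + k + 1 - g + 1 - rs.length = k + 2 - rs.length by omega,
      show g + k + 1 - g - ν = k + 1 - ν by omega]
    exact ⟨e1.trans e2.symm⟩
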